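/- All graphs are finite, simple and undirected, with a nonempty vertex set. The direct product $X\times Y$ and the Cartesian product $X\square Y$ of graphs $X,Y$ both have as vertex set the set of pairs $(i,\alpha)$, with $i$ a vertex of $X$ and $\alpha$ a vertex of $Y$. Their edges are given by $$X\times Y:\quad (i,\alpha)\sim(j,\beta)\iff i\sim j \text{ and } \alpha\sim\beta,$$ $$X\square Y:\quad (i,\alpha)\sim(j,\beta)\iff (i=j \text{ and } \alpha\sim\beta)\text{ or }(i\sim j\text{ and }\alpha=\beta).$$ For a graph $X$ with adjacency matrix $d$, let $A(X)$ be the universal unital $C^*$-algebra generated by elements $u_{ij}$ ($i,j$ vertices of $X$) such that $u=(u_{ij})$ is a magic unitary (every entry is a projection, and the entries in each row and in each column are pairwise orthogonal with sum $1$) and $du=ud$. It is a Hopf $C^*$-algebra with $$\Delta(u_{ij})=\sum_k u_{ik}\otimes u_{kj},\qquad \varepsilon(u_{ij})=\delta_{ij},\qquad S(u_{ij})=u_{ji}.$$ Here a Hopf $C^*$-algebra is a unital $C^*$-algebra $A$ with unital $*$-homomorphisms $\Delta:A\to A\otimes A$, $\varepsilon:A\to\mathbb C$, $S:A\to A^{op}$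 satisfying coassociativity, the counit axioms, the antipode axioms on a dense Hopf $*$-subalgebra, and $S^2=\mathrm{id}$, where $\otimes$ is the maximal $C^*$-tensor product. A tensor product $A\otimes B$ of Hopf $C^*$-algebras is again one, with $\Delta_{A\otimes B}=(\mathrm{id}\otimes\sigma\otimes\mathrm{id})(\Delta_A\otimes\Delta_B)$ ($\sigma$ the flip), $\varepsilon_A\otimes\varepsilon_B$ and $S_A\otimes S_B$. A morphism of Hopf $C^*$-algebras is a unital $*$-homomorphism compatible with $\Delta$, $\varepsilon$ and $S$. **Proposition 4.1.** Let $X,Y$ be graphs as above, and let $u$ and $v$ be the generating magic unitaries of $A(X)$ and $A(Y)$. There are surjective morphisms of Hopf $C^*$-algebras $$A(X\times Y)\to A(X)\otimes A(Y),\qquad A(X\square Y)\to A(X)\otimes A(Y),$$ each of which maps the generator with index $\big((i,\alpha),(j,\beta)\big)$ to $u_{ij}\otimes v_{\alpha\beta}$, for all vertices $i,j$ of $X$ and $\alpha,\beta$ of $Y$. -/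

import Mathlib

set_option linter.unusedSectionVars false

open scoped TensorProduct

/-! ### Universal C*-algebras -/

/-- A C*-seminorm on a unital complex *-algebra: a submultiplicative seminorm `p` that satisfies
the C*-identity `p (a* a) = p a ^ 2`. -/
structure CStarSeminorm (P : Type*) [Ring P] [StarRing P] [Algebra ℂ P] extends
    Seminorm ℂ P where
  mul_le' : ∀ a b : P, toFun (a * b) ≤ toFun a * toFun b
  star_mul_self' : ∀ a : P, toFun (star a * a) = toFun a * toFun a

namespace CStarSeminorm

section Basic

variable {P : Type*} [Ring P] [StarRing P] [Algebra ℂ P] (p : CStarSeminorm P)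

theorem mul_le (a b : P) : p.toSeminorm (a * b) ≤ p.toSeminorm a * p.toSeminorm b :=
  p.mul_le' a b

theorem star_mul_self (a : P) : p.toSeminorm (star a * a) = p.toSeminorm a * p.toSeminorm a :=
  p.star_mul_self' a

theorem le_star (a : P) : p.toSeminorm a ≤ p.toSeminorm (star a) := by
  rcases (apply_nonneg p.toSeminorm a).eq_or_lt with h | h
  · rw [← h]; exact apply_nonneg _ _
  · have h1 := p.star_mul_self a
    have h2 := p.mul_le (star a) a
    rw [h1] at h2
    exact le_of_mul_le_mul_right h2 h

theorem star_eq (a : P) : p.toSeminorm (star a) = p.toSeminorm a := by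
  refine le_antisymm ?_ (p.le_star a)
  simpa using p.le_star (star a)

/-- The *-algebra `P`, considered with the topology of the C*-seminorm `p`. -/
def Pre (_ : CStarSeminorm P) : Type _ := P

noncomputable instance : Ring p.Pre := inferInstanceAs (Ring P)
noncomputable instance : StarRing p.Pre := inferInstanceAs (StarRing P)
noncomputable instance : Algebra ℂ p.Pre := inferInstanceAs (Algebra ℂ P)
instance [StarModule ℂ P] : StarModule ℂ p.Pre := inferInstanceAs (StarModule ℂ P)

/-- The seminorm `p` on `p.Pre`. -/
def preSeminorm : AddGroupSeminorm p.Pre where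
  toFun := p.toFun
  map_zero' := p.map_zero'
  add_le' := p.add_le'
  neg' := p.neg'

noncomputable instance : SeminormedRing p.Pre where
  __ := (inferInstance : Ring p.Pre)
  __ := p.preSeminorm.toSeminormedAddCommGroup
  norm_mul_le := p.mul_le'

theorem norm_def (a : p.Pre) : ‖a‖ = p.toSeminorm (show P from a) := rfl

noncomputable instance : NormedSpace ℂ p.Pre where
  __ := (inferInstance : Module ℂ p.Pre)
  norm_smul_le z a := (p.smul' z a).le

instance : NormedStarGroup p.Pre where
  norm_star_le a := (p.star_eq a).le

/-- The Hausdorff completion of `P` with respect to the C*-seminorm `p`. -/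
def Compl : Type _ := UniformSpace.Completion p.Pre

noncomputable instance : NormedRing p.Compl :=
  inferInstanceAs (NormedRing (UniformSpace.Completion p.Pre))

instance : CompleteSpace p.Compl :=
  inferInstanceAs (CompleteSpace (UniformSpace.Completion p.Pre))

noncomputable instance : Algebra ℂ p.Compl :=
  inferInstanceAs (Algebra ℂ (UniformSpace.Completion p.Pre))

noncomputable instance : NormedAlgebra ℂ p.Compl where
  norm_smul_le z x :=
    norm_smul_le (α := ℂ) (β := UniformSpace.Completion p.Pre) z x

/-- The canonical map from `P` to its completion. -/
noncomputable def coe (a : P) : p.Compl := ((show p.Pre from a : p.Pre) : UniformSpace.Completion p.Pre)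

theorem norm_coe (a : P) : ‖p.coe a‖ = p.toSeminorm a :=
  UniformSpace.Completion.norm_coe (show p.Pre from a)

theorem coe_add (a b : P) : p.coe (a + b) = p.coe a + p.coe b :=
  UniformSpace.Completion.coe_add (show p.Pre from a) (show p.Pre from b)

theorem coe_mul (a b : P) : p.coe (a * b) = p.coe a * p.coe b :=
  UniformSpace.Completion.coe_mul (show p.Pre from a) (show p.Pre from b)

theorem coe_one : p.coe 1 = 1 := rfl

theorem denseRange_coe : DenseRange p.coe :=
  UniformSpace.Completion.denseRange_coe (α := p.Pre)

theorem coe_algebraMap (z : ℂ) : p.coe (algebraMap ℂ P z) = algebraMap ℂ p.Compl z := rfl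

theorem compl_induction {C : p.Compl → Prop} (x : p.Compl) (hC : IsClosed {x | C x})
    (h : ∀ a : P, C (p.coe a)) : C x :=
  UniformSpace.Completion.induction_on (α := p.Pre) x hC h

noncomputable instance : Star p.Compl where
  star := UniformSpace.Completion.map (star : p.Pre → p.Pre)

theorem uniformContinuous_star_pre : UniformContinuous (star : p.Pre → p.Pre) :=
  (starNormedAddGroupHom (E := p.Pre)).uniformContinuous

theorem continuous_star_compl : Continuous (star : p.Compl → p.Compl) :=
  UniformSpace.Completion.continuous_map (α := p.Pre) (β := p.Pre)

instance : ContinuousStar p.Compl := ⟨p.continuous_star_compl⟩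

theorem coe_star (a : P) : p.coe (star a) = star (p.coe a) :=
  (UniformSpace.Completion.map_coe p.uniformContinuous_star_pre (show p.Pre from a)).symm

noncomputable instance : StarRing p.Compl where
  star_involutive x := by
    refine p.compl_induction (C := fun x => star (star x) = x) x
      (isClosed_eq (by fun_prop) (by fun_prop)) fun a => ?_
    rw [← coe_star, ← coe_star, star_star]
  star_mul x y := by
    refine p.compl_induction (C := fun x => star (x * y) = star y * star x) x
      (isClosed_eq (by fun_prop) (by fun_prop)) fun a => ?_
    refine p.compl_induction (C := fun y => star (p.coe a * y) = star y * star (p.coe a)) y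
      (isClosed_eq (by fun_prop) (by fun_prop)) fun b => ?_
    rw [← coe_mul, ← coe_star, ← coe_star, ← coe_star, ← coe_mul, star_mul]
  star_add x y := by
    refine p.compl_induction (C := fun x => star (x + y) = star x + star y) x
      (isClosed_eq (by fun_prop) (by fun_prop)) fun a => ?_
    refine p.compl_induction (C := fun y => star (p.coe a + y) = star (p.coe a) + star y) y
      (isClosed_eq (by fun_prop) (by fun_prop)) fun b => ?_
    rw [← coe_add, ← coe_star, ← coe_star, ← coe_star, ← coe_add, star_add]

theorem coe_smul (z : ℂ) (a : P) : p.coe (z • a) = z • p.coe a := by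
  rw [Algebra.smul_def, coe_mul, coe_algebraMap, ← Algebra.smul_def]

end Basic

variable {P : Type*} [Ring P] [StarRing P] [Algebra ℂ P] [StarModule ℂ P] (p : CStarSeminorm P)

instance : CStarRing p.Compl where
  norm_mul_self_le x := by
    refine p.compl_induction (C := fun x => ‖x‖ * ‖x‖ ≤ ‖star x * x‖) x
      (isClosed_le (by fun_prop) (by fun_prop)) fun a => ?_
    rw [← coe_star, ← coe_mul, norm_coe, norm_coe, star_mul_self]

instance : StarModule ℂ p.Compl where
  star_smul z x := by
    refine p.compl_induction (C := fun x => star (z • x) = star z • star x) x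
      (isClosed_eq (p.continuous_star_compl.comp (continuous_const_smul z))
        (p.continuous_star_compl.const_smul (star z))) fun a => ?_
    rw [← coe_smul, ← coe_star, ← coe_star, ← coe_smul, star_smul]

noncomputable instance : CStarAlgebra p.Compl where

/-- The canonical *-homomorphism from `P` to its completion. -/
noncomputable def of : P →⋆ₐ[ℂ] p.Compl where
  toFun := p.coe
  map_one' := p.coe_one
  map_mul' := p.coe_mul
  map_zero' := UniformSpace.Completion.coe_zero (α := p.Pre)
  map_add' := p.coe_add
  commutes' := p.coe_algebraMap
  map_star' := p.coe_star

theorem norm_of (a : P) : ‖p.of a‖ = p.toSeminorm a := p.norm_coe a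

theorem denseRange_of : DenseRange p.of := p.denseRange_coe

/-- The C*-seminorm `a ↦ ‖f a‖` given by a *-homomorphism `f` to a C*-algebra. -/
noncomputable def ofHom {B : Type*} [CStarAlgebra B] (f : P →⋆ₐ[ℂ] B) : CStarSeminorm P where
  toFun a := ‖f a‖
  map_zero' := by simp
  add_le' a b := by rw [map_add]; exact norm_add_le _ _
  neg' a := by simp
  smul' z a := by rw [map_smul, norm_smul]
  mul_le' a b := by rw [map_mul]; exact norm_mul_le _ _
  star_mul_self' a := by rw [map_mul, map_star]; exact CStarRing.norm_star_mul_self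

theorem ofHom_apply {B : Type*} [CStarAlgebra B] (f : P →⋆ₐ[ℂ] B) (a : P) :
    (ofHom f).toSeminorm a = ‖f a‖ := rfl

/-- On a C*-algebra every C*-seminorm is dominated by the norm. -/
theorem le_norm {A : Type*} [CStarAlgebra A] (q : CStarSeminorm A) (a : A) :
    q.toSeminorm a ≤ ‖a‖ := by
  rw [← q.norm_of]
  exact NonUnitalStarAlgHom.norm_apply_le q.of a

/-- Extension of a *-homomorphism to the completion. -/
theorem exists_lift {B : Type*} [CStarAlgebra B] (f : P →⋆ₐ[ℂ] B)
    (hf : ∀ a, ‖f a‖ ≤ p.toSeminorm a) : ∃ g : p.Compl →⋆ₐ[ℂ] B, ∀ a, g (p.of a) = f a := by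
  let f' : p.Pre →+* B := (f : P →+* B)
  have hc : Continuous f' := by
    refine AddMonoidHomClass.continuous_of_bound f' 1 fun a => ?_
    rw [one_mul]
    exact hf a
  let g : p.Compl →+* B := UniformSpace.Completion.extensionHom f' hc
  have hg : ∀ a, g (p.coe a) = f a := fun a => UniformSpace.Completion.extensionHom_coe f' hc a
  have hgc : Continuous g := UniformSpace.Completion.continuous_extension
  refine ⟨{ g with
    commutes' := fun z => ?_
    map_star' := fun x => ?_ }, hg⟩
  · change g (algebraMap ℂ p.Compl z) = _
    rw [← coe_algebraMap, hg]
    exact AlgHomClass.commutes f z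
  · change g (star x) = star (g x)
    refine p.compl_induction (C := fun x => g (star x) = star (g x)) x
      (isClosed_eq (by fun_prop) (by fun_prop)) fun a => ?_
    rw [← coe_star, hg, hg, map_star]

end CStarSeminorm

theorem StarAlgHom.continuous_cstar {A B : Type*} [CStarAlgebra A] [CStarAlgebra B]
    (f : A →⋆ₐ[ℂ] B) : Continuous f :=
  AddMonoidHomClass.continuous_of_bound f 1 fun a => by
    rw [one_mul]; exact NonUnitalStarAlgHom.norm_apply_le f a

section Universal

variable {P : Type*} [Ring P] [StarRing P] [Algebra ℂ P]

/-- The values at `a` of all C*-seminorms on `P` that vanish on the relations `R`. -/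
def cstarValues (R : Set P) (a : P) : Set ℝ :=
  {x | ∃ p : CStarSeminorm P, (∀ r ∈ R, p.toSeminorm r = 0) ∧ p.toSeminorm a = x}

/-- The relations `R` bound the C*-seminorms: this is the condition for the existence of the
universal C*-algebra of the *-algebra `P` with relations `R`. -/
class HasUniversalCStar (R : Set P) : Prop where
  bddAbove : ∀ a : P, BddAbove (cstarValues R a)

theorem zero_mem_cstarValues (R : Set P) (a : P) : (0 : ℝ) ∈ cstarValues R a :=
  ⟨{ toSeminorm := 0
     mul_le' := fun _ _ => by change (0 : ℝ) ≤ 0 * 0; simp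
     star_mul_self' := fun _ => by change (0 : ℝ) = 0 * 0; simp }, fun _ _ => rfl, rfl⟩

variable (R : Set P) [hR : HasUniversalCStar R]

theorem le_sSup_cstarValues {R : Set P} [hR : HasUniversalCStar R] (p : CStarSeminorm P)
    (hp : ∀ r ∈ R, p.toSeminorm r = 0) (a : P) : p.toSeminorm a ≤ sSup (cstarValues R a) :=
  le_csSup (hR.bddAbove a) ⟨p, hp, rfl⟩

/-- The largest C*-seminorm on `P` that vanishes on `R`. -/
noncomputable def universalSeminorm : CStarSeminorm P where
  toFun a := sSup (cstarValues R a)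
  map_zero' := by
    refine le_antisymm (csSup_le ⟨_, zero_mem_cstarValues R 0⟩ ?_)
      (le_csSup (hR.bddAbove 0) (zero_mem_cstarValues R 0))
    rintro _ ⟨p, _, rfl⟩
    rw [map_zero]
  add_le' a b := by
    refine csSup_le ⟨_, zero_mem_cstarValues R _⟩ ?_
    rintro _ ⟨p, hp, rfl⟩
    exact (map_add_le_add p.toSeminorm a b).trans
      (add_le_add (le_sSup_cstarValues p hp a) (le_sSup_cstarValues p hp b))
  neg' a := by
    congr 1
    ext x
    simp [cstarValues, map_neg_eq_map]
  smul' z a := by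
    have key : ∀ (w : ℂ) (c : P),
        sSup (cstarValues R (w • c)) ≤ ‖w‖ * sSup (cstarValues R c) := by
      intro w c
      refine csSup_le ⟨_, zero_mem_cstarValues R _⟩ ?_
      rintro _ ⟨p, hp, rfl⟩
      rw [map_smul_eq_mul]
      exact mul_le_mul_of_nonneg_left (le_sSup_cstarValues p hp c) (norm_nonneg w)
    refine le_antisymm (key z a) ?_
    rcases eq_or_ne z 0 with rfl | hz
    · rw [norm_zero, zero_mul]
      exact le_csSup (hR.bddAbove _) (zero_mem_cstarValues R _)
    · have h := key z⁻¹ (z • a)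
      rw [inv_smul_smul₀ hz, norm_inv] at h
      have hz' : 0 < ‖z‖ := norm_pos_iff.mpr hz
      calc ‖z‖ * sSup (cstarValues R a)
          ≤ ‖z‖ * (‖z‖⁻¹ * sSup (cstarValues R (z • a))) :=
            mul_le_mul_of_nonneg_left h hz'.le
        _ = _ := by rw [mul_inv_cancel_left₀ hz'.ne']
  mul_le' a b := by
    refine csSup_le ⟨_, zero_mem_cstarValues R _⟩ ?_
    rintro _ ⟨p, hp, rfl⟩
    exact (p.mul_le a b).trans
      (mul_le_mul (le_sSup_cstarValues p hp a) (le_sSup_cstarValues p hp b)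
        (apply_nonneg _ _) ((apply_nonneg p.toSeminorm a).trans (le_sSup_cstarValues p hp a)))
  star_mul_self' a := by
    have h0 : 0 ≤ sSup (cstarValues R a) :=
      le_csSup (hR.bddAbove _) (zero_mem_cstarValues R _)
    have h0' : 0 ≤ sSup (cstarValues R (star a * a)) :=
      le_csSup (hR.bddAbove _) (zero_mem_cstarValues R _)
    apply le_antisymm
    · refine csSup_le ⟨_, zero_mem_cstarValues R _⟩ ?_
      rintro _ ⟨p, hp, rfl⟩
      rw [p.star_mul_self]
      exact mul_self_le_mul_self (apply_nonneg _ _) (le_sSup_cstarValues p hp a)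
    · have h1 : sSup (cstarValues R a) ≤ Real.sqrt (sSup (cstarValues R (star a * a))) := by
        refine csSup_le ⟨_, zero_mem_cstarValues R _⟩ ?_
        rintro _ ⟨p, hp, rfl⟩
        apply Real.le_sqrt_of_sq_le
        rw [sq, ← p.star_mul_self]
        exact le_sSup_cstarValues p hp _
      calc _ ≤ _ := mul_self_le_mul_self h0 h1
        _ = _ := Real.mul_self_sqrt h0'

variable [StarModule ℂ P]

/-- The universal C*-algebra of the *-algebra `P` with relations `r = 0`, `r ∈ R`: the Hausdorff
completion of `P` with respect to the largest C*-seminorm that vanishes on `R`. -/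
def UniversalCStar : Type _ := (universalSeminorm R).Compl

namespace UniversalCStar

noncomputable instance : CStarAlgebra (UniversalCStar R) :=
  inferInstanceAs (CStarAlgebra (universalSeminorm R).Compl)

/-- The canonical *-homomorphism to the universal C*-algebra. -/
noncomputable def of : P →⋆ₐ[ℂ] UniversalCStar R := (universalSeminorm R).of

theorem denseRange_of : DenseRange (of R) := (universalSeminorm R).denseRange_of

theorem of_eq_zero {r : P} (hr : r ∈ R) : of R r = 0 := by
  rw [← norm_eq_zero]
  refine ((universalSeminorm R).norm_of r).trans ?_
  refine le_antisymm (csSup_le ⟨_, zero_mem_cstarValues R r⟩ ?_)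
      (le_csSup (hR.bddAbove r) (zero_mem_cstarValues R r))
  rintro _ ⟨p, hp, rfl⟩
  exact (hp r hr).le

variable {R} {B : Type*} [CStarAlgebra B]

theorem exists_lift (f : P →⋆ₐ[ℂ] B) (hf : ∀ r ∈ R, f r = 0) :
    ∃ g : UniversalCStar R →⋆ₐ[ℂ] B, ∀ a, g (of R a) = f a :=
  (universalSeminorm R).exists_lift f fun a =>
    le_sSup_cstarValues (CStarSeminorm.ofHom f)
      (fun r hr => by rw [CStarSeminorm.ofHom_apply, hf r hr, norm_zero]) a

/-- The universal property: a *-homomorphism from `P` to a C*-algebra that kills the relations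
extends to the universal C*-algebra. -/
noncomputable def lift (f : P →⋆ₐ[ℂ] B) (hf : ∀ r ∈ R, f r = 0) : UniversalCStar R →⋆ₐ[ℂ] B :=
  (exists_lift f hf).choose

theorem lift_of (f : P →⋆ₐ[ℂ] B) (hf : ∀ r ∈ R, f r = 0) (a : P) : lift f hf (of R a) = f a :=
  (exists_lift f hf).choose_spec a

theorem hom_ext {f g : UniversalCStar R →⋆ₐ[ℂ] B} (h : ∀ a, f (of R a) = g (of R a)) : f = g :=
  DFunLike.coe_injective ((denseRange_of R).equalizer f.continuous_cstar g.continuous_cstar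
    (funext h))

end UniversalCStar

end Universal

/-! ### The maximal tensor product of C*-algebras -/

section MaxTensor

variable (A B : Type*) [CStarAlgebra A] [CStarAlgebra B]

/-- The canonical map from `A` to the algebraic tensor product, as a *-homomorphism. -/
noncomputable def algInl : A →⋆ₐ[ℂ] A ⊗[ℂ] B where
  __ := (Algebra.TensorProduct.includeLeft : A →ₐ[ℂ] A ⊗[ℂ] B)
  map_star' a := by simp

/-- The canonical map from `B` to the algebraic tensor product, as a *-homomorphism. -/
noncomputable def algInr : B →⋆ₐ[ℂ] A ⊗[ℂ] B where
  __ := (Algebra.TensorProduct.includeRight : B →ₐ[ℂ] A ⊗[ℂ] B)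
  map_star' a := by simp

theorem algInl_apply (a : A) : algInl A B a = a ⊗ₜ[ℂ] 1 := rfl

theorem algInr_apply (b : B) : algInr A B b = 1 ⊗ₜ[ℂ] b := rfl

/-- The composition of a C*-seminorm with a *-homomorphism. -/
noncomputable def CStarSeminorm.comp {P Q : Type*} [Ring P] [StarRing P] [Algebra ℂ P]
    [Ring Q] [StarRing Q] [Algebra ℂ Q] (p : CStarSeminorm Q) (f : P →⋆ₐ[ℂ] Q) :
    CStarSeminorm P where
  toSeminorm := p.toSeminorm.comp (f : P →ₐ[ℂ] Q).toLinearMap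
  mul_le' a b := by
    change p.toSeminorm (f (a * b)) ≤ p.toSeminorm (f a) * p.toSeminorm (f b)
    rw [map_mul]; exact p.mul_le _ _
  star_mul_self' a := by
    change p.toSeminorm (f (star a * a)) = p.toSeminorm (f a) * p.toSeminorm (f a)
    rw [map_mul, map_star]; exact p.star_mul_self _

instance : HasUniversalCStar (∅ : Set (A ⊗[ℂ] B)) where
  bddAbove x := by
    induction x with
    | zero => exact ⟨0, by rintro _ ⟨p, _, rfl⟩; rw [map_zero]⟩
    | tmul a b =>
      refine ⟨‖a‖ * ‖b‖, ?_⟩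
      rintro _ ⟨p, _, rfl⟩
      have h : a ⊗ₜ[ℂ] b = algInl A B a * algInr A B b := by simp [algInl_apply, algInr_apply]
      rw [h]
      exact (p.mul_le _ _).trans (mul_le_mul ((p.comp (algInl A B)).le_norm a)
        ((p.comp (algInr A B)).le_norm b) (apply_nonneg _ _) (norm_nonneg _))
    | add x y hx hy =>
      obtain ⟨c, hc⟩ := hx
      obtain ⟨d, hd⟩ := hy
      refine ⟨c + d, ?_⟩
      rintro _ ⟨p, hp, rfl⟩
      exact (map_add_le_add p.toSeminorm x y).trans
        (add_le_add (hc ⟨p, hp, rfl⟩) (hd ⟨p, hp, rfl⟩))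

/-- The (maximal) C*-tensor product of two unital C*-algebras: the completion of the algebraic
tensor product over `ℂ` with respect to its largest C*-seminorm. -/
def MaxTensor : Type _ := UniversalCStar (∅ : Set (A ⊗[ℂ] B))

namespace MaxTensor

noncomputable instance : CStarAlgebra (MaxTensor A B) :=
  inferInstanceAs (CStarAlgebra (UniversalCStar (∅ : Set (A ⊗[ℂ] B))))

/-- The canonical *-homomorphism from the algebraic to the C*-tensor product. -/
noncomputable def of : A ⊗[ℂ] B →⋆ₐ[ℂ] MaxTensor A B := UniversalCStar.of ∅

theorem denseRange_of : DenseRange (of A B) := UniversalCStar.denseRange_of _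

/-- `a ↦ a ⊗ 1`. -/
noncomputable def inl : A →⋆ₐ[ℂ] MaxTensor A B := (of A B).comp (algInl A B)

/-- `b ↦ 1 ⊗ b`. -/
noncomputable def inr : B →⋆ₐ[ℂ] MaxTensor A B := (of A B).comp (algInr A B)

variable {A B}

/-- The elementary tensor `a ⊗ b`. -/
noncomputable def tmul (a : A) (b : B) : MaxTensor A B := of A B (a ⊗ₜ[ℂ] b)

theorem of_tmul (a : A) (b : B) : of A B (a ⊗ₜ[ℂ] b) = inl A B a * inr A B b := by
  change _ = of A B (algInl A B a) * of A B (algInr A B b)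
  rw [← map_mul]
  simp [algInl_apply, algInr_apply]

theorem tmul_eq (a : A) (b : B) : tmul a b = inl A B a * inr A B b := of_tmul a b

theorem inl_commute_inr (a : A) (b : B) : Commute (inl A B a) (inr A B b) := by
  change of A B (algInl A B a) * of A B (algInr A B b)
    = of A B (algInr A B b) * of A B (algInl A B a)
  rw [← map_mul, ← map_mul]
  simp [algInl_apply, algInr_apply]

variable {C D E : Type*} [CStarAlgebra C] [CStarAlgebra D] [CStarAlgebra E]

/-- The *-homomorphism on the algebraic tensor product given by two commuting ones. -/
noncomputable def algLift (f : A →⋆ₐ[ℂ] C) (g : B →⋆ₐ[ℂ] C)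
    (h : ∀ a b, Commute (f a) (g b)) : A ⊗[ℂ] B →⋆ₐ[ℂ] C where
  __ := Algebra.TensorProduct.lift (f : A →ₐ[ℂ] C) (g : B →ₐ[ℂ] C) h
  map_star' x := by
    induction x with
    | zero => simp
    | tmul a b =>
      change Algebra.TensorProduct.lift (f : A →ₐ[ℂ] C) (g : B →ₐ[ℂ] C) h _
        = star (Algebra.TensorProduct.lift (f : A →ₐ[ℂ] C) (g : B →ₐ[ℂ] C) h _)
      rw [TensorProduct.star_tmul, Algebra.TensorProduct.lift_tmul,
        Algebra.TensorProduct.lift_tmul]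
      change f (star a) * g (star b) = star (f a * g b)
      rw [(h a b).eq, star_mul, map_star, map_star]
    | add x y hx hy =>
      change Algebra.TensorProduct.lift (f : A →ₐ[ℂ] C) (g : B →ₐ[ℂ] C) h _
        = star (Algebra.TensorProduct.lift (f : A →ₐ[ℂ] C) (g : B →ₐ[ℂ] C) h _)
      rw [star_add, map_add, map_add, star_add]
      exact congrArg₂ _ hx hy

/-- Two *-homomorphisms with commuting ranges induce a *-homomorphism `a ⊗ b ↦ f a * g b` on the
C*-tensor product. -/
noncomputable def lift (f : A →⋆ₐ[ℂ] C) (g : B →⋆ₐ[ℂ] C)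
    (h : ∀ a b, Commute (f a) (g b)) : MaxTensor A B →⋆ₐ[ℂ] C :=
  UniversalCStar.lift (algLift f g h) (by simp)

theorem lift_of (f : A →⋆ₐ[ℂ] C) (g : B →⋆ₐ[ℂ] C) (h : ∀ a b, Commute (f a) (g b))
    (x : A ⊗[ℂ] B) : lift f g h (of A B x) = algLift f g h x :=
  UniversalCStar.lift_of _ _ x

@[simp]
theorem lift_inl (f : A →⋆ₐ[ℂ] C) (g : B →⋆ₐ[ℂ] C) (h : ∀ a b, Commute (f a) (g b)) (a : A) :
    lift f g h (inl A B a) = f a := by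
  refine (lift_of f g h _).trans ?_
  change Algebra.TensorProduct.lift (f : A →ₐ[ℂ] C) (g : B →ₐ[ℂ] C) h (a ⊗ₜ 1) = f a
  rw [Algebra.TensorProduct.lift_tmul, map_one, mul_one]
  rfl

@[simp]
theorem lift_inr (f : A →⋆ₐ[ℂ] C) (g : B →⋆ₐ[ℂ] C) (h : ∀ a b, Commute (f a) (g b)) (b : B) :
    lift f g h (inr A B b) = g b := by
  refine (lift_of f g h _).trans ?_
  change Algebra.TensorProduct.lift (f : A →ₐ[ℂ] C) (g : B →ₐ[ℂ] C) h (1 ⊗ₜ b) = g b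
  rw [Algebra.TensorProduct.lift_tmul, map_one, one_mul]
  rfl

theorem hom_ext {f g : MaxTensor A B →⋆ₐ[ℂ] C} (h₁ : ∀ a, f (inl A B a) = g (inl A B a))
    (h₂ : ∀ b, f (inr A B b) = g (inr A B b)) : f = g := by
  refine UniversalCStar.hom_ext fun x => ?_
  change f (of A B x) = g (of A B x)
  induction x with
  | zero => simp
  | tmul a b => rw [of_tmul, map_mul, map_mul, h₁, h₂]
  | add x y hx hy => rw [map_add, map_add, map_add, hx, hy]

theorem commute_of (f : MaxTensor A B →⋆ₐ[ℂ] C) (z : C)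
    (h₁ : ∀ a, Commute (f (inl A B a)) z) (h₂ : ∀ b, Commute (f (inr A B b)) z)
    (x : MaxTensor A B) : Commute (f x) z := by
  refine (denseRange_of A B).induction_on (p := fun x => f x * z = z * f x) x
    (isClosed_eq (f.continuous_cstar.mul continuous_const)
      (continuous_const.mul f.continuous_cstar)) fun x => ?_
  induction x with
  | zero => simp
  | tmul a b => rw [of_tmul, map_mul]; exact (h₁ a).mul_left (h₂ b)
  | add x y hx hy => rw [map_add, map_add, add_mul, mul_add, hx, hy]

/-- The tensor product `f ⊗ g` of two *-homomorphisms. -/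
noncomputable def map (f : A →⋆ₐ[ℂ] C) (g : B →⋆ₐ[ℂ] D) : MaxTensor A B →⋆ₐ[ℂ] MaxTensor C D :=
  lift ((inl C D).comp f) ((inr C D).comp g) fun _ _ => inl_commute_inr _ _

@[simp]
theorem map_inl (f : A →⋆ₐ[ℂ] C) (g : B →⋆ₐ[ℂ] D) (a : A) :
    map f g (inl A B a) = inl C D (f a) := lift_inl _ _ _ _

@[simp]
theorem map_inr (f : A →⋆ₐ[ℂ] C) (g : B →⋆ₐ[ℂ] D) (b : B) :
    map f g (inr A B b) = inr C D (g b) := lift_inr _ _ _ _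

variable (A B C) in
/-- The canonical *-homomorphism `(A ⊗ B) ⊗ C → A ⊗ (B ⊗ C)`. -/
noncomputable def assoc :
    MaxTensor (MaxTensor A B) C →⋆ₐ[ℂ] MaxTensor A (MaxTensor B C) :=
  lift (map (.id ℂ A) (inl B C)) ((inr A (MaxTensor B C)).comp (inr B C)) fun x c =>
    commute_of _ _ (fun a => by simpa using inl_commute_inr _ _)
      (fun b => by
        simpa using (inl_commute_inr b c).map (inr A (MaxTensor B C))) x

@[simp]
theorem assoc_inl (x : MaxTensor A B) :
    assoc A B C (inl _ C x) = map (.id ℂ A) (inl B C) x := lift_inl _ _ _ _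

@[simp]
theorem assoc_inr (c : C) :
    assoc A B C (inr _ C c) = inr A (MaxTensor B C) (inr B C c) := lift_inr _ _ _ _

variable (A) in
/-- The canonical *-homomorphism `ℂ ⊗ A → A`. -/
noncomputable def lid : MaxTensor ℂ A →⋆ₐ[ℂ] A :=
  lift (StarAlgHom.ofId ℂ A) (.id ℂ A) fun z a => Algebra.commutes z a

variable (A) in
/-- The canonical *-homomorphism `A ⊗ ℂ → A`. -/
noncomputable def rid : MaxTensor A ℂ →⋆ₐ[ℂ] A :=
  lift (.id ℂ A) (StarAlgHom.ofId ℂ A) fun a z => (Algebra.commutes z a).symm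

theorem lid_inl (z : ℂ) : lid A (inl ℂ A z) = algebraMap ℂ A z := lift_inl _ _ _ _

theorem lid_inr (a : A) : lid A (inr ℂ A a) = a := lift_inr _ _ _ _

theorem rid_inl (a : A) : rid A (inl A ℂ a) = a := lift_inl _ _ _ _

theorem rid_inr (z : ℂ) : rid A (inr A ℂ z) = algebraMap ℂ A z := lift_inr _ _ _ _

end MaxTensor

end MaxTensor

/-! ### Hopf C*-algebras -/

section Hopf

open MulOpposite

/-- The linear map underlying a *-homomorphism `S : A → Aᵐᵒᵖ`. -/
noncomputable def opLinear {A : Type*} [CStarAlgebra A] (S : A →⋆ₐ[ℂ] Aᵐᵒᵖ) : A →ₗ[ℂ] A where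
  toFun a := unop (S a)
  map_add' a b := by rw [map_add, unop_add]
  map_smul' z a := by rw [map_smul, unop_smul, RingHom.id_apply]

/-- The axiom of the antipode at an element `a`, with respect to a *-subalgebra `A₀`:
`Δ a` is the image of an element `t` of the algebraic tensor product `A₀ ⊗ A₀`, and
`m (S ⊗ id) t = ε a = m (id ⊗ S) t`, where `m` is the multiplication. -/
def AntipodeAxiomAt {A : Type*} [CStarAlgebra A] (Δ : A →⋆ₐ[ℂ] MaxTensor A A) (ε : A →⋆ₐ[ℂ] ℂ)
    (S : A →⋆ₐ[ℂ] Aᵐᵒᵖ) (A₀ : StarSubalgebra ℂ A) (a : A) : Prop :=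
  ∃ t : A₀ ⊗[ℂ] A₀,
    Δ a = MaxTensor.of A A
      (TensorProduct.map A₀.subtype.toAlgHom.toLinearMap A₀.subtype.toAlgHom.toLinearMap t) ∧
    LinearMap.mul' ℂ A (TensorProduct.map
      (opLinear S ∘ₗ A₀.subtype.toAlgHom.toLinearMap) A₀.subtype.toAlgHom.toLinearMap t)
      = algebraMap ℂ A (ε a) ∧
    LinearMap.mul' ℂ A (TensorProduct.map
      A₀.subtype.toAlgHom.toLinearMap (opLinear S ∘ₗ A₀.subtype.toAlgHom.toLinearMap) t)
      = algebraMap ℂ A (ε a)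

/-- A Hopf C*-algebra: a unital C*-algebra `A` with *-homomorphisms `Δ : A → A ⊗ A`, `ε : A → ℂ`
and `S : A → Aᵐᵒᵖ`, subject to coassociativity, the counit axioms, the antipode axioms, and
`S ∘ S = id`. The multiplication `A ⊗ A → A` is not defined on the whole C*-tensor product, so the
antipode axioms are imposed, as usual, on a dense Hopf *-subalgebra of `A`. -/
class HopfCStarAlgebra (A : Type*) [CStarAlgebra A] where
  comul : A →⋆ₐ[ℂ] MaxTensor A A
  counit : A →⋆ₐ[ℂ] ℂ
  antipode : A →⋆ₐ[ℂ] Aᵐᵒᵖ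
  coassoc : (MaxTensor.assoc A A A).comp ((MaxTensor.map comul (.id ℂ A)).comp comul)
    = (MaxTensor.map (.id ℂ A) comul).comp comul
  counit_left : (MaxTensor.lid A).comp ((MaxTensor.map counit (.id ℂ A)).comp comul) = .id ℂ A
  counit_right : (MaxTensor.rid A).comp ((MaxTensor.map (.id ℂ A) counit).comp comul) = .id ℂ A
  antipode_antipode : ∀ a, unop (antipode (unop (antipode a))) = a
  exists_dense : ∃ A₀ : StarSubalgebra ℂ A, Dense (A₀ : Set A) ∧
    (∀ a ∈ A₀, unop (antipode a) ∈ A₀) ∧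
    ∀ a ∈ A₀, AntipodeAxiomAt comul counit antipode A₀ a

/-- A morphism of Hopf C*-algebras: a *-homomorphism compatible with the comultiplications,
the counits and the antipodes. -/
structure IsHopfCStarHom {A B : Type*} [CStarAlgebra A] [CStarAlgebra B] [HopfCStarAlgebra A]
    [HopfCStarAlgebra B] (f : A →⋆ₐ[ℂ] B) : Prop where
  comul_apply : ∀ a, HopfCStarAlgebra.comul (f a)
    = MaxTensor.map f f (HopfCStarAlgebra.comul a)
  counit_apply : ∀ a, HopfCStarAlgebra.counit (f a) = HopfCStarAlgebra.counit a
  antipode_apply : ∀ a, unop (HopfCStarAlgebra.antipode (f a))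
    = f (unop (HopfCStarAlgebra.antipode a))

section Antipode

variable {A : Type*} [CStarAlgebra A] {Δ : A →⋆ₐ[ℂ] MaxTensor A A} {ε : A →⋆ₐ[ℂ] ℂ}
  {S : A →⋆ₐ[ℂ] Aᵐᵒᵖ} {A₀ : StarSubalgebra ℂ A}

theorem AntipodeAxiomAt.of_algebraMap (z : ℂ) :
    AntipodeAxiomAt Δ ε S A₀ (algebraMap ℂ A z) := by
  refine ⟨algebraMap ℂ (A₀ ⊗[ℂ] A₀) z, ?_, ?_, ?_⟩
  · rw [Algebra.TensorProduct.algebraMap_apply, TensorProduct.map_tmul, AlgHomClass.commutes]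
    have : (algebraMap ℂ A z) ⊗ₜ[ℂ] (1 : A) = algebraMap ℂ (A ⊗[ℂ] A) z := rfl
    exact ((AlgHomClass.commutes (MaxTensor.of A A) z).symm.trans
      (congrArg (MaxTensor.of A A) this.symm))
  · rw [Algebra.TensorProduct.algebraMap_apply, TensorProduct.map_tmul, LinearMap.mul'_apply,
      AlgHomClass.commutes ε]
    change unop (S (algebraMap ℂ A z)) * 1 = algebraMap ℂ A z
    rw [AlgHomClass.commutes, mul_one]
    rfl
  · rw [Algebra.TensorProduct.algebraMap_apply, TensorProduct.map_tmul, LinearMap.mul'_apply,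
      AlgHomClass.commutes ε]
    change algebraMap ℂ A z * unop (S 1) = algebraMap ℂ A z
    rw [map_one, unop_one, mul_one]

theorem AntipodeAxiomAt.add {a b : A} (ha : AntipodeAxiomAt Δ ε S A₀ a)
    (hb : AntipodeAxiomAt Δ ε S A₀ b) : AntipodeAxiomAt Δ ε S A₀ (a + b) := by
  obtain ⟨s, h1, h2, h3⟩ := ha
  obtain ⟨t, h4, h5, h6⟩ := hb
  refine ⟨s + t, ?_, ?_, ?_⟩
  · rw [map_add, map_add, map_add, h1, h4]
  · rw [map_add, map_add, map_add, map_add, h2, h5]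
  · rw [map_add, map_add, map_add, map_add, h3, h6]

theorem AntipodeAxiomAt.mul {a b : A} (ha : AntipodeAxiomAt Δ ε S A₀ a)
    (hb : AntipodeAxiomAt Δ ε S A₀ b) : AntipodeAxiomAt Δ ε S A₀ (a * b) := by
  obtain ⟨s, h1, h2, h3⟩ := ha
  obtain ⟨t, h4, h5, h6⟩ := hb
  refine ⟨s * t, ?_, ?_, ?_⟩
  · rw [map_mul, h1, h4, ← map_mul]
    congr 1
    exact (map_mul (Algebra.TensorProduct.map A₀.subtype.toAlgHom A₀.subtype.toAlgHom) s t).symm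
  · -- `m (S ⊗ id) (s t) = ∑ S(y) (m (S ⊗ id) s) y'` for `t = ∑ y ⊗ y'`
    set φ : A₀ ⊗[ℂ] A₀ →ₗ[ℂ] A := LinearMap.mul' ℂ A ∘ₗ TensorProduct.map
      (opLinear S ∘ₗ A₀.subtype.toAlgHom.toLinearMap) A₀.subtype.toAlgHom.toLinearMap with hφ
    change φ (s * t) = _
    change φ s = _ at h2
    change φ t = _ at h5
    have hp : ∀ x y : A₀, φ (x ⊗ₜ y) = unop (S x) * y := fun x y => rfl
    have key : ∀ (s : A₀ ⊗[ℂ] A₀) (x y : A₀), φ (s * x ⊗ₜ y) = unop (S x) * φ s * y := by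
      intro s x y
      induction s with
      | zero => simp
      | tmul u v =>
        rw [Algebra.TensorProduct.tmul_mul_tmul, hp, hp]
        push_cast
        rw [map_mul, unop_mul]
        simp only [mul_assoc]
      | add u v hu hv => rw [add_mul, map_add, hu, hv, map_add, mul_add, add_mul]
    have : ∀ t : A₀ ⊗[ℂ] A₀, φ (s * t) = algebraMap ℂ A (ε a) * φ t := by
      intro t
      induction t with
      | zero => simp
      | tmul x y => rw [key, h2, hp, ← Algebra.commutes, mul_assoc]
      | add u v hu hv => rw [mul_add, map_add, hu, hv, map_add, mul_add]
    rw [this, h5, map_mul, map_mul]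
  · set φ : A₀ ⊗[ℂ] A₀ →ₗ[ℂ] A := LinearMap.mul' ℂ A ∘ₗ TensorProduct.map
      A₀.subtype.toAlgHom.toLinearMap (opLinear S ∘ₗ A₀.subtype.toAlgHom.toLinearMap) with hφ
    change φ (s * t) = _
    change φ s = _ at h3
    change φ t = _ at h6
    have hp : ∀ x y : A₀, φ (x ⊗ₜ y) = x * unop (S y) := fun x y => rfl
    have key : ∀ (t : A₀ ⊗[ℂ] A₀) (x y : A₀), φ (x ⊗ₜ y * t) = x * φ t * unop (S y) := by
      intro t x y
      induction t with
      | zero => simp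
      | tmul u v =>
        rw [Algebra.TensorProduct.tmul_mul_tmul, hp, hp]
        push_cast
        rw [map_mul, unop_mul]
        simp only [mul_assoc]
      | add u v hu hv => rw [mul_add, map_add, hu, hv, map_add, mul_add, add_mul]
    have : ∀ s : A₀ ⊗[ℂ] A₀, φ (s * t) = φ s * algebraMap ℂ A (ε b) := by
      intro s
      induction s with
      | zero => simp
      | tmul x y => rw [key, h6, hp, mul_assoc, Algebra.commutes, ← mul_assoc]
      | add u v hu hv => rw [add_mul, map_add, hu, hv, map_add, add_mul]
    rw [this, h3, map_mul, map_mul]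

/-- The antipode axioms may be checked on a self-adjoint set of generators of a dense
*-subalgebra. -/
theorem exists_dense_of_generators (G : Set A) (hstar : star G = G)
    (hdense : Dense (StarAlgebra.adjoin ℂ G : Set A))
    (hS : ∀ a ∈ G, unop (S a) ∈ StarAlgebra.adjoin ℂ G)
    (hG : ∀ a ∈ G, AntipodeAxiomAt Δ ε S (StarAlgebra.adjoin ℂ G) a) :
    ∃ A₀ : StarSubalgebra ℂ A, Dense (A₀ : Set A) ∧ (∀ a ∈ A₀, unop (S a) ∈ A₀) ∧
      ∀ a ∈ A₀, AntipodeAxiomAt Δ ε S A₀ a := by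
  have hmem : ∀ a, a ∈ StarAlgebra.adjoin ℂ G → a ∈ Algebra.adjoin ℂ G := by
    intro a ha
    rw [← StarSubalgebra.mem_toSubalgebra, StarAlgebra.adjoin_toSubalgebra, hstar,
      Set.union_self] at ha
    exact ha
  refine ⟨StarAlgebra.adjoin ℂ G, hdense, fun a ha => ?_, fun a ha => ?_⟩
  · induction hmem a ha using Algebra.adjoin_induction with
    | mem x hx => exact hS x hx
    | algebraMap z =>
      rw [AlgHomClass.commutes]
      exact algebraMap_mem (StarAlgebra.adjoin ℂ G) z
    | add x y hx hy h1 h2 =>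
      rw [map_add, unop_add]
      refine add_mem (h1 ?_) (h2 ?_) <;>
      rwa [← StarSubalgebra.mem_toSubalgebra, StarAlgebra.adjoin_toSubalgebra, hstar,
        Set.union_self]
    | mul x y hx hy h1 h2 =>
      rw [map_mul, unop_mul]
      refine mul_mem (h2 ?_) (h1 ?_) <;>
      rwa [← StarSubalgebra.mem_toSubalgebra, StarAlgebra.adjoin_toSubalgebra, hstar,
        Set.union_self]
  · have h := hmem a ha
    clear ha
    induction h using Algebra.adjoin_induction with
    | mem x hx => exact hG x hx
    | algebraMap z => exact .of_algebraMap z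
    | add x y hx hy h1 h2 => exact h1.add h2
    | mul x y hx hy h1 h2 => exact h1.mul h2

end Antipode

section TensorHopf

/-- The composition of `S` with itself, for `S : A → Aᵐᵒᵖ`. -/
noncomputable def antipodeSq {A : Type*} [CStarAlgebra A] (S : A →⋆ₐ[ℂ] Aᵐᵒᵖ) : A →⋆ₐ[ℂ] A where
  toFun a := unop (S (unop (S a)))
  map_one' := by simp
  map_mul' a b := by simp
  map_zero' := by simp
  map_add' a b := by simp
  commutes' z := by
    rw [AlgHomClass.commutes]
    change unop (S (algebraMap ℂ A z)) = _
    rw [AlgHomClass.commutes]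
    rfl
  map_star' a := by
    rw [map_star, unop_star, map_star, unop_star]

/-- A *-homomorphism `A → B`, as a *-homomorphism between the opposite algebras. -/
noncomputable def opHom {A B : Type*} [CStarAlgebra A] [CStarAlgebra B] (f : A →⋆ₐ[ℂ] B) :
    Aᵐᵒᵖ →⋆ₐ[ℂ] Bᵐᵒᵖ where
  toFun a := op (f (unop a))
  map_one' := by simp
  map_mul' a b := by simp
  map_zero' := by simp
  map_add' a b := by simp
  commutes' z := by
    change op (f (algebraMap ℂ A z)) = _
    rw [AlgHomClass.commutes]
    rfl
  map_star' a := by rw [unop_star, map_star, op_star]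

@[simp]
theorem unop_opHom {A B : Type*} [CStarAlgebra A] [CStarAlgebra B] (f : A →⋆ₐ[ℂ] B) (a : Aᵐᵒᵖ) :
    unop (opHom f a) = f (unop a) := rfl

/-- Transport of the antipode axiom along a *-homomorphism compatible with the structure maps. -/
theorem AntipodeAxiomAt.map {A B : Type*} [CStarAlgebra A] [CStarAlgebra B]
    {Δ : A →⋆ₐ[ℂ] MaxTensor A A} {ε : A →⋆ₐ[ℂ] ℂ} {S : A →⋆ₐ[ℂ] Aᵐᵒᵖ} {A₀ : StarSubalgebra ℂ A}
    {Δ' : B →⋆ₐ[ℂ] MaxTensor B B} {ε' : B →⋆ₐ[ℂ] ℂ} {S' : B →⋆ₐ[ℂ] Bᵐᵒᵖ}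
    {B₀ : StarSubalgebra ℂ B} (f : A →⋆ₐ[ℂ] B) (hf : ∀ a ∈ A₀, f a ∈ B₀)
    (hΔ : ∀ a, Δ' (f a) = MaxTensor.map f f (Δ a)) (hε : ∀ a, ε' (f a) = ε a)
    (hS : ∀ a, unop (S' (f a)) = f (unop (S a))) {a : A} (ha : AntipodeAxiomAt Δ ε S A₀ a) :
    AntipodeAxiomAt Δ' ε' S' B₀ (f a) := by
  obtain ⟨t, h1, h2, h3⟩ := ha
  let f₀ : A₀ →ₗ[ℂ] B₀ :=
    { toFun := fun x => ⟨f x, hf x x.2⟩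
      map_add' := fun x y => Subtype.ext (map_add f _ _)
      map_smul' := fun z x => Subtype.ext (map_smul f _ _) }
  have hof : ∀ x : A ⊗[ℂ] A, MaxTensor.map f f (MaxTensor.of A A x)
      = MaxTensor.of B B (TensorProduct.map f.toAlgHom.toLinearMap f.toAlgHom.toLinearMap x) := by
    intro x
    induction x with
    | zero => simp
    | tmul x y =>
      rw [MaxTensor.of_tmul, TensorProduct.map_tmul, MaxTensor.of_tmul, map_mul,
        MaxTensor.map_inl, MaxTensor.map_inr]
      rfl
    | add x y hx hy => simp only [map_add, hx, hy]
  refine ⟨TensorProduct.map f₀ f₀ t, ?_, ?_, ?_⟩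
  · rw [hΔ, h1, hof]
    congr 1
    rw [← LinearMap.comp_apply, ← LinearMap.comp_apply, ← TensorProduct.map_comp,
      ← TensorProduct.map_comp]
    rfl
  · rw [hε, ← AlgHomClass.commutes f, ← h2]
    clear h1 h2 h3
    induction t with
    | zero => simp
    | tmul x y =>
      change unop (S' (f x)) * f y = f (unop (S x) * y)
      rw [hS, map_mul]
    | add x y hx hy => simp only [map_add, hx, hy]
  · rw [hε, ← AlgHomClass.commutes f, ← h3]
    clear h1 h2 h3
    induction t with
    | zero => simp
    | tmul x y =>
      change f x * unop (S' (f y)) = f (x * unop (S y))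
      rw [hS, map_mul]
    | add x y hx hy => simp only [map_add, hx, hy]

namespace MaxTensor

variable {A B : Type*} [CStarAlgebra A] [CStarAlgebra B] [HopfCStarAlgebra A] [HopfCStarAlgebra B]

variable (A B) in
/-- The comultiplication of a tensor product: `(id ⊗ σ ⊗ id) (Δ ⊗ Δ)`, where `σ` is the flip. -/
noncomputable def tensorComul :
    MaxTensor A B →⋆ₐ[ℂ] MaxTensor (MaxTensor A B) (MaxTensor A B) :=
  lift ((map (inl A B) (inl A B)).comp HopfCStarAlgebra.comul)
    ((map (inr A B) (inr A B)).comp HopfCStarAlgebra.comul) fun a b => by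
      refine commute_of _ _ (fun a' => ?_) (fun a' => ?_) _ <;>
      refine (commute_of _ _ (fun b' => ?_) (fun b' => ?_) _).symm
      · simpa using (inl_commute_inr a' b').symm.map (inl (MaxTensor A B) (MaxTensor A B))
      · simpa using (inl_commute_inr _ _).symm
      · simpa using (inl_commute_inr _ _)
      · simpa using (inl_commute_inr a' b').symm.map (inr (MaxTensor A B) (MaxTensor A B))

variable (A B) in
/-- The counit `ε ⊗ ε` of a tensor product. -/
noncomputable def tensorCounit : MaxTensor A B →⋆ₐ[ℂ] ℂ :=
  lift HopfCStarAlgebra.counit HopfCStarAlgebra.counit fun _ _ => Commute.all _ _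

variable (A B) in
/-- The antipode `S ⊗ S` of a tensor product. -/
noncomputable def tensorAntipode : MaxTensor A B →⋆ₐ[ℂ] (MaxTensor A B)ᵐᵒᵖ :=
  lift ((opHom (inl A B)).comp HopfCStarAlgebra.antipode)
    ((opHom (inr A B)).comp HopfCStarAlgebra.antipode) fun a b => by
      apply unop_injective
      exact (inl_commute_inr (unop (HopfCStarAlgebra.antipode a))
        (unop (HopfCStarAlgebra.antipode b))).symm

@[simp]
theorem tensorComul_inl (a : A) : tensorComul A B (inl A B a)
    = map (inl A B) (inl A B) (HopfCStarAlgebra.comul a) := lift_inl _ _ _ _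

@[simp]
theorem tensorComul_inr (b : B) : tensorComul A B (inr A B b)
    = map (inr A B) (inr A B) (HopfCStarAlgebra.comul b) := lift_inr _ _ _ _

@[simp]
theorem tensorCounit_inl (a : A) : tensorCounit A B (inl A B a) = HopfCStarAlgebra.counit a :=
  lift_inl _ _ _ _

@[simp]
theorem tensorCounit_inr (b : B) : tensorCounit A B (inr A B b) = HopfCStarAlgebra.counit b :=
  lift_inr _ _ _ _

@[simp]
theorem tensorAntipode_inl (a : A) : tensorAntipode A B (inl A B a)
    = op (inl A B (unop (HopfCStarAlgebra.antipode a))) := lift_inl _ _ _ _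

@[simp]
theorem tensorAntipode_inr (b : B) : tensorAntipode A B (inr A B b)
    = op (inr A B (unop (HopfCStarAlgebra.antipode b))) := lift_inr _ _ _ _

section Natural

variable {A₁ A₂ A₃ B₁ B₂ B₃ : Type*} [CStarAlgebra A₁] [CStarAlgebra A₂] [CStarAlgebra A₃]
  [CStarAlgebra B₁] [CStarAlgebra B₂] [CStarAlgebra B₃]

theorem map_map (f : A₁ →⋆ₐ[ℂ] A₂) (f' : A₂ →⋆ₐ[ℂ] A₃) (g : B₁ →⋆ₐ[ℂ] B₂) (g' : B₂ →⋆ₐ[ℂ] B₃)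
    (x : MaxTensor A₁ B₁) : map f' g' (map f g x) = map (f'.comp f) (g'.comp g) x :=
  DFunLike.congr_fun (f := (map f' g').comp (map f g))
    (hom_ext (fun a => by simp) (fun b => by simp)) x

theorem assoc_natural (f : A₁ →⋆ₐ[ℂ] B₁) (g : A₂ →⋆ₐ[ℂ] B₂) (h : A₃ →⋆ₐ[ℂ] B₃)
    (x : MaxTensor (MaxTensor A₁ A₂) A₃) :
    assoc B₁ B₂ B₃ (map (map f g) h x) = map f (map g h) (assoc A₁ A₂ A₃ x) := by
  refine DFunLike.congr_fun (f := (assoc B₁ B₂ B₃).comp (map (map f g) h))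
    (g := (map f (map g h)).comp (assoc A₁ A₂ A₃)) (hom_ext (fun a => ?_) (fun b => ?_)) x
  · simp only [StarAlgHom.comp_apply, map_inl, assoc_inl, map_map]
    congr 1
    refine congrArg₂ map ?_ ?_
    · ext; rfl
    · ext; simp
  · simp

theorem lid_natural (f : A₁ →⋆ₐ[ℂ] B₁) (x : MaxTensor ℂ A₁) :
    lid B₁ (map (.id ℂ ℂ) f x) = f (lid A₁ x) := by
  refine DFunLike.congr_fun (f := (lid B₁).comp (map (.id ℂ ℂ) f))
    (g := f.comp (lid A₁)) (hom_ext (fun a => ?_) (fun b => ?_)) x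
  · rw [StarAlgHom.comp_apply, StarAlgHom.comp_apply, map_inl, lid_inl, lid_inl]
    exact (AlgHomClass.commutes f a).symm
  · rw [StarAlgHom.comp_apply, StarAlgHom.comp_apply, map_inr, lid_inr, lid_inr]

theorem rid_natural (f : A₁ →⋆ₐ[ℂ] B₁) (x : MaxTensor A₁ ℂ) :
    rid B₁ (map f (.id ℂ ℂ) x) = f (rid A₁ x) := by
  refine DFunLike.congr_fun (f := (rid B₁).comp (map f (.id ℂ ℂ)))
    (g := f.comp (rid A₁)) (hom_ext (fun a => ?_) (fun b => ?_)) x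
  · rw [StarAlgHom.comp_apply, StarAlgHom.comp_apply, map_inl, rid_inl, rid_inl]
  · rw [StarAlgHom.comp_apply, StarAlgHom.comp_apply, map_inr, rid_inr, rid_inr]
    exact (AlgHomClass.commutes f b).symm

/-- A *-homomorphism compatible with comultiplications transports coassociativity. -/
theorem coassoc_transport (f : A₁ →⋆ₐ[ℂ] B₁) (Δ : A₁ →⋆ₐ[ℂ] MaxTensor A₁ A₁)
    (Δ' : B₁ →⋆ₐ[ℂ] MaxTensor B₁ B₁) (hΔ : ∀ a, Δ' (f a) = map f f (Δ a))
    (h : (assoc A₁ A₁ A₁).comp ((map Δ (.id ℂ A₁)).comp Δ) = (map (.id ℂ A₁) Δ).comp Δ) (a : A₁) :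
    assoc B₁ B₁ B₁ (map Δ' (.id ℂ B₁) (Δ' (f a))) = map (.id ℂ B₁) Δ' (Δ' (f a)) := by
  have e1 : Δ'.comp f = (map f f).comp Δ := by ext a; exact hΔ a
  have e2 : (StarAlgHom.id ℂ B₁).comp f = f.comp (StarAlgHom.id ℂ A₁) := by ext; rfl
  have h' : assoc A₁ A₁ A₁ (map Δ (.id ℂ A₁) (Δ a)) = map (.id ℂ A₁) Δ (Δ a) :=
    DFunLike.congr_fun h a
  rw [hΔ, map_map, map_map, e1, e2, ← map_map, ← map_map, assoc_natural, h']

theorem counit_left_transport (f : A₁ →⋆ₐ[ℂ] B₁) (Δ : A₁ →⋆ₐ[ℂ] MaxTensor A₁ A₁)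
    (Δ' : B₁ →⋆ₐ[ℂ] MaxTensor B₁ B₁) (ε : A₁ →⋆ₐ[ℂ] ℂ) (ε' : B₁ →⋆ₐ[ℂ] ℂ)
    (hΔ : ∀ a, Δ' (f a) = map f f (Δ a)) (hε : ∀ a, ε' (f a) = ε a)
    (h : (lid A₁).comp ((map ε (.id ℂ A₁)).comp Δ) = .id ℂ A₁) (a : A₁) :
    lid B₁ (map ε' (.id ℂ B₁) (Δ' (f a))) = f a := by
  have e1 : ε'.comp f = (StarAlgHom.id ℂ ℂ).comp ε := by ext a; exact hε a
  have e2 : (StarAlgHom.id ℂ B₁).comp f = f.comp (StarAlgHom.id ℂ A₁) := by ext; rfl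
  have h' : lid A₁ (map ε (.id ℂ A₁) (Δ a)) = a := DFunLike.congr_fun h a
  rw [hΔ, map_map, e1, e2, ← map_map, lid_natural, h']

theorem counit_right_transport (f : A₁ →⋆ₐ[ℂ] B₁) (Δ : A₁ →⋆ₐ[ℂ] MaxTensor A₁ A₁)
    (Δ' : B₁ →⋆ₐ[ℂ] MaxTensor B₁ B₁) (ε : A₁ →⋆ₐ[ℂ] ℂ) (ε' : B₁ →⋆ₐ[ℂ] ℂ)
    (hΔ : ∀ a, Δ' (f a) = map f f (Δ a)) (hε : ∀ a, ε' (f a) = ε a)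
    (h : (rid A₁).comp ((map (.id ℂ A₁) ε).comp Δ) = .id ℂ A₁) (a : A₁) :
    rid B₁ (map (.id ℂ B₁) ε' (Δ' (f a))) = f a := by
  have e1 : ε'.comp f = (StarAlgHom.id ℂ ℂ).comp ε := by ext a; exact hε a
  have e2 : (StarAlgHom.id ℂ B₁).comp f = f.comp (StarAlgHom.id ℂ A₁) := by ext; rfl
  have h' : rid A₁ (map (.id ℂ A₁) ε (Δ a)) = a := DFunLike.congr_fun h a
  rw [hΔ, map_map, e1, e2, ← map_map, rid_natural, h']

end Natural

/-- If `A₀` and `B₀` are dense in `A` and `B`, the *-subalgebra generated by `a ⊗ 1` and `1 ⊗ b`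
for `a ∈ A₀` and `b ∈ B₀` is dense in `A ⊗ B`. -/
theorem dense_adjoin {A B : Type*} [CStarAlgebra A] [CStarAlgebra B] {A₀ : Set A} {B₀ : Set B}
    (hA : Dense A₀) (hB : Dense B₀) :
    Dense (StarAlgebra.adjoin ℂ (inl A B '' A₀ ∪ inr A B '' B₀) : Set (MaxTensor A B)) := by
  set T := StarAlgebra.adjoin ℂ (inl A B '' A₀ ∪ inr A B '' B₀) with hT
  have h1 : ∀ a, inl A B a ∈ T.topologicalClosure := fun a =>
    closure_minimal (s := A₀) (t := inl A B ⁻¹' (T.topologicalClosure : Set (MaxTensor A B)))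
      (fun a ha => T.le_topologicalClosure (StarAlgebra.subset_adjoin ℂ _ (Or.inl ⟨a, ha, rfl⟩)))
      (T.isClosed_topologicalClosure.preimage (inl A B).continuous_cstar) (hA a)
  have h2 : ∀ b, inr A B b ∈ T.topologicalClosure := fun b =>
    closure_minimal (s := B₀) (t := inr A B ⁻¹' (T.topologicalClosure : Set (MaxTensor A B)))
      (fun b hb => T.le_topologicalClosure (StarAlgebra.subset_adjoin ℂ _ (Or.inr ⟨b, hb, rfl⟩)))
      (T.isClosed_topologicalClosure.preimage (inr A B).continuous_cstar) (hB b)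
  intro x
  change x ∈ T.topologicalClosure
  refine (denseRange_of A B).induction_on (p := fun x => x ∈ T.topologicalClosure) x
    T.isClosed_topologicalClosure fun y => ?_
  induction y with
  | zero => rw [map_zero]; exact zero_mem _
  | tmul a b => rw [of_tmul]; exact mul_mem (h1 a) (h2 b)
  | add x y hx hy => rw [map_add]; exact add_mem hx hy

/-- The tensor product of two Hopf C*-algebras. -/
noncomputable instance : HopfCStarAlgebra (MaxTensor A B) where
  comul := tensorComul A B
  counit := tensorCounit A B
  antipode := tensorAntipode A B
  coassoc := hom_ext
    (coassoc_transport _ _ _ tensorComul_inl HopfCStarAlgebra.coassoc)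
    (coassoc_transport _ _ _ tensorComul_inr HopfCStarAlgebra.coassoc)
  counit_left := hom_ext
    (counit_left_transport _ _ _ _ _ tensorComul_inl tensorCounit_inl
      HopfCStarAlgebra.counit_left)
    (counit_left_transport _ _ _ _ _ tensorComul_inr tensorCounit_inr
      HopfCStarAlgebra.counit_left)
  counit_right := hom_ext
    (counit_right_transport _ _ _ _ _ tensorComul_inl tensorCounit_inl
      HopfCStarAlgebra.counit_right)
    (counit_right_transport _ _ _ _ _ tensorComul_inr tensorCounit_inr
      HopfCStarAlgebra.counit_right)
  antipode_antipode := DFunLike.congr_fun (f := antipodeSq (tensorAntipode A B))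
    (g := .id ℂ (MaxTensor A B)) (hom_ext
      (fun a => by
        change unop (tensorAntipode A B (unop (tensorAntipode A B (inl A B a)))) = inl A B a
        rw [tensorAntipode_inl, unop_op, tensorAntipode_inl, unop_op,
          HopfCStarAlgebra.antipode_antipode])
      (fun b => by
        change unop (tensorAntipode A B (unop (tensorAntipode A B (inr A B b)))) = inr A B b
        rw [tensorAntipode_inr, unop_op, tensorAntipode_inr, unop_op,
          HopfCStarAlgebra.antipode_antipode]))
  exists_dense := by
    obtain ⟨A₀, hA, hSA, hAA⟩ := HopfCStarAlgebra.exists_dense (A := A)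
    obtain ⟨B₀, hB, hSB, hBB⟩ := HopfCStarAlgebra.exists_dense (A := B)
    have hl : ∀ a ∈ A₀, inl A B a ∈ StarAlgebra.adjoin ℂ
        (inl A B '' (A₀ : Set A) ∪ inr A B '' (B₀ : Set B)) := fun a ha =>
      StarAlgebra.subset_adjoin ℂ _ (Or.inl ⟨a, ha, rfl⟩)
    have hr : ∀ b ∈ B₀, inr A B b ∈ StarAlgebra.adjoin ℂ
        (inl A B '' (A₀ : Set A) ∪ inr A B '' (B₀ : Set B)) := fun b hb =>
      StarAlgebra.subset_adjoin ℂ _ (Or.inr ⟨b, hb, rfl⟩)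
    refine exists_dense_of_generators
      (inl A B '' (A₀ : Set A) ∪ inr A B '' (B₀ : Set B)) ?_ (dense_adjoin hA hB) ?_ ?_
    · refine Set.Subset.antisymm ?_ ?_
      · rintro x (⟨a, ha, h⟩ | ⟨b, hb, h⟩)
        · exact Or.inl ⟨star a, star_mem ha, by rw [map_star, h, star_star]⟩
        · exact Or.inr ⟨star b, star_mem hb, by rw [map_star, h, star_star]⟩
      · rintro _ (⟨a, ha, rfl⟩ | ⟨b, hb, rfl⟩)
        · exact Or.inl ⟨star a, star_mem ha, map_star _ _⟩
        · exact Or.inr ⟨star b, star_mem hb, map_star _ _⟩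
    · rintro _ (⟨a, ha, rfl⟩ | ⟨b, hb, rfl⟩)
      · rw [tensorAntipode_inl]; exact hl _ (hSA a ha)
      · rw [tensorAntipode_inr]; exact hr _ (hSB b hb)
    · rintro _ (⟨a, ha, rfl⟩ | ⟨b, hb, rfl⟩)
      · exact (hAA a ha).map (inl A B) hl tensorComul_inl tensorCounit_inl
          fun a => by rw [tensorAntipode_inl, unop_op]
      · exact (hBB b hb).map (inr A B) hr tensorComul_inr tensorCounit_inr
          fun b => by rw [tensorAntipode_inr, unop_op]

end MaxTensor

end TensorHopf

end Hopf

/-! ### The free *-algebra on self-adjoint generators -/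

section FreeStar

open MulOpposite

/-- The free unital complex *-algebra on a set `S` of self-adjoint generators: as an algebra it is
the free algebra, and the involution is conjugate linear, reverses words and fixes `S`. -/
def FreeStar (S : Type*) : Type _ := FreeAlgebra ℂ S

namespace FreeStar

variable {S : Type*}

noncomputable instance : Ring (FreeStar S) := inferInstanceAs (Ring (FreeAlgebra ℂ S))
noncomputable instance : Algebra ℂ (FreeStar S) := inferInstanceAs (Algebra ℂ (FreeAlgebra ℂ S))

/-- The generators. -/
noncomputable def gen (s : S) : FreeStar S := FreeAlgebra.ι ℂ s

theorem induction {C : FreeStar S → Prop} (hz : ∀ z : ℂ, C (algebraMap ℂ _ z))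
    (hg : ∀ s, C (gen s)) (hm : ∀ a b, C a → C b → C (a * b)) (ha : ∀ a b, C a → C b → C (a + b))
    (a : FreeStar S) : C a :=
  FreeAlgebra.induction ℂ S (motive := C) hz hg hm ha a

/-- The opposite algebra, with the conjugate scalar multiplication. -/
def ConjOp (S : Type*) : Type _ := (FreeStar S)ᵐᵒᵖ

noncomputable instance : Ring (ConjOp S) := inferInstanceAs (Ring (FreeStar S)ᵐᵒᵖ)

noncomputable instance : Algebra ℂ (ConjOp S) :=
  RingHom.toAlgebra' (((algebraMap ℂ (FreeStar S)ᵐᵒᵖ).comp (starRingEnd ℂ) :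
    ℂ →+* (FreeStar S)ᵐᵒᵖ) : ℂ →+* ConjOp S) fun z x =>
    Algebra.commutes (A := (FreeStar S)ᵐᵒᵖ) (starRingEnd ℂ z) x

variable (S) in
/-- The homomorphism to the twisted opposite algebra that fixes the generators. -/
noncomputable def starAlgHom : FreeStar S →ₐ[ℂ] ConjOp S :=
  FreeAlgebra.lift ℂ (A := ConjOp S) fun s => (op (gen s) : (FreeStar S)ᵐᵒᵖ)

/-- The conjugate linear antihomomorphism that fixes the generators. -/
noncomputable def starHom : FreeStar S →+* (FreeStar S)ᵐᵒᵖ :=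
  (starAlgHom S).toRingHom

theorem starHom_gen (s : S) : starHom (gen s) = op (gen s) :=
  FreeAlgebra.lift_ι_apply (A := ConjOp S) (fun s => (op (gen s) : (FreeStar S)ᵐᵒᵖ)) s

theorem starHom_algebraMap (z : ℂ) :
    starHom (algebraMap ℂ (FreeStar S) z) = op (algebraMap ℂ (FreeStar S) (star z)) :=
  (starAlgHom S).commutes z

noncomputable instance : Star (FreeStar S) where
  star a := unop (starHom a)

theorem star_def (a : FreeStar S) : star a = unop (starHom a) := rfl

noncomputable instance : StarRing (FreeStar S) where
  star_involutive a := by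
    induction a using FreeStar.induction with
    | hz z => rw [star_def, star_def, starHom_algebraMap, unop_op, starHom_algebraMap, unop_op,
        star_star]
    | hg s => rw [star_def, star_def, starHom_gen, unop_op, starHom_gen, unop_op]
    | hm a b h1 h2 =>
      rw [star_def, star_def] at *
      rw [map_mul, unop_mul, map_mul, unop_mul, h1, h2]
    | ha a b h1 h2 =>
      rw [star_def, star_def] at *
      rw [map_add, unop_add, map_add, unop_add, h1, h2]
  star_mul a b := by rw [star_def, map_mul, unop_mul]; rfl
  star_add a b := by rw [star_def, map_add, unop_add]; rfl

theorem star_gen (s : S) : star (gen s) = gen s := by rw [star_def, starHom_gen, unop_op]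

theorem star_algebraMap (z : ℂ) :
    star (algebraMap ℂ (FreeStar S) z) = algebraMap ℂ (FreeStar S) (star z) := by
  rw [star_def, starHom_algebraMap, unop_op]

instance : StarModule ℂ (FreeStar S) where
  star_smul z a := by
    rw [Algebra.smul_def, star_mul, star_algebraMap, ← Algebra.commutes, ← Algebra.smul_def]

/-- The universal property: self-adjoint elements `b s` of a *-algebra determine a
*-homomorphism. -/
noncomputable def lift {B : Type*} [Ring B] [StarRing B] [Algebra ℂ B] [StarModule ℂ B]
    (b : S → B) (hb : ∀ s, star (b s) = b s) : FreeStar S →⋆ₐ[ℂ] B where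
  __ := (FreeAlgebra.lift ℂ b : FreeAlgebra ℂ S →ₐ[ℂ] B)
  map_star' a := by
    let φ : FreeStar S →ₐ[ℂ] B := (FreeAlgebra.lift ℂ b : FreeAlgebra ℂ S →ₐ[ℂ] B)
    have hφ : ∀ s, φ (gen s) = b s := fun s => FreeAlgebra.lift_ι_apply b s
    change φ (star a) = star (φ a)
    induction a using FreeStar.induction with
    | hz z => rw [star_algebraMap, φ.commutes, φ.commutes, algebraMap_star_comm]
    | hg s => rw [star_gen, hφ, hb]
    | hm a b h1 h2 => rw [star_mul, map_mul, map_mul, star_mul, h1, h2]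
    | ha a b h1 h2 => rw [star_add, map_add, map_add, star_add, h1, h2]

theorem lift_gen {B : Type*} [Ring B] [StarRing B] [Algebra ℂ B] [StarModule ℂ B]
    (b : S → B) (hb : ∀ s, star (b s) = b s) (s : S) : lift b hb (gen s) = b s :=
  FreeAlgebra.lift_ι_apply b s

end FreeStar

end FreeStar

/-! ### Quantum automorphism groups of graphs -/

section Graph

open MulOpposite

/-- A magic unitary matrix: all entries are projections, and every row and every column is a
partition of unity, that is, consists of pairwise orthogonal projections with sum `1`. -/
structure IsMagicUnitary {V A : Type*} [Fintype V] [Ring A] [StarRing A] (u : Matrix V V A) :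
    Prop where
  isStarProjection : ∀ i j, IsStarProjection (u i j)
  row_orthogonal : ∀ i j k, j ≠ k → u i j * u i k = 0
  col_orthogonal : ∀ i j k, i ≠ j → u i k * u j k = 0
  row_sum : ∀ i, ∑ j, u i j = 1
  col_sum : ∀ j, ∑ i, u i j = 1

variable {V : Type*} [Fintype V]

/-- The direct (categorical) product of graphs: `(i, α) ∼ (j, β)` if and only if `i ∼ j` and
`α ∼ β`. -/
def directProduct {V W : Type*} (X : SimpleGraph V) (Y : SimpleGraph W) :
    SimpleGraph (V × W) where
  Adj x y := X.Adj x.1 y.1 ∧ Y.Adj x.2 y.2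
  symm := ⟨fun _ _ h => ⟨h.1.symm, h.2.symm⟩⟩
  loopless := ⟨fun _ h => h.1.ne rfl⟩

/-- The square matrix of generators of the free *-algebra. -/
noncomputable def genMatrix (V : Type*) : Matrix V V (FreeStar (V × V)) :=
  fun i j => FreeStar.gen (i, j)

open Classical in
/-- The relations of the quantum automorphism group of the graph `X`, for the matrix `u` of
(self-adjoint) generators: `u` is a magic unitary, and `d u = u d` for the adjacency matrix `d`. -/
def graphRelations (X : SimpleGraph V) : Set (FreeStar (V × V)) :=
  let u := genMatrix V
  let d := X.adjMatrix (FreeStar (V × V))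
  {r | (∃ i j, r = u i j * u i j - u i j) ∨
    (∃ i j k, j ≠ k ∧ r = u i j * u i k) ∨
    (∃ i j k, i ≠ j ∧ r = u i k * u j k) ∨
    (∃ i, r = ∑ j, u i j - 1) ∨
    (∃ j, r = ∑ i, u i j - 1) ∨
    (∃ i j, r = (d * u - u * d) i j)}

instance (X : SimpleGraph V) : HasUniversalCStar (graphRelations X) where
  bddAbove a := by
    induction a using FreeStar.induction with
    | hz z =>
      refine ⟨‖algebraMap ℂ ℂ z‖, ?_⟩
      rintro _ ⟨p, _, rfl⟩
      rw [Algebra.algebraMap_eq_smul_one, map_smul_eq_mul]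
      have h : p.toSeminorm (1 : FreeStar (V × V)) ≤ 1 := by
        have h := p.star_mul_self 1
        rw [star_one, one_mul] at h
        nlinarith
      exact mul_le_of_le_one_right (norm_nonneg _) h
    | hg s =>
      refine ⟨1, ?_⟩
      rintro _ ⟨p, hp, rfl⟩
      have h1 := p.star_mul_self (FreeStar.gen s)
      rw [FreeStar.star_gen] at h1
      have h2 := hp (FreeStar.gen s * FreeStar.gen s - FreeStar.gen s)
        (Or.inl ⟨s.1, s.2, rfl⟩)
      have h3 := map_add_le_add p.toSeminorm
        (-(FreeStar.gen s * FreeStar.gen s - FreeStar.gen s)) (FreeStar.gen s)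
      have h4 := map_add_le_add p.toSeminorm
        (FreeStar.gen s * FreeStar.gen s - FreeStar.gen s) (FreeStar.gen s)
      rw [map_neg_eq_map, h2, zero_add] at h3
      rw [h2, zero_add, sub_add_cancel, h1] at h4
      nlinarith
    | hm a b ha hb =>
      obtain ⟨c, hc⟩ := ha
      obtain ⟨d, hd⟩ := hb
      refine ⟨c * d, ?_⟩
      rintro _ ⟨p, hp, rfl⟩
      have h1 := hc ⟨p, hp, rfl⟩
      exact (p.mul_le a b).trans (mul_le_mul h1 (hd ⟨p, hp, rfl⟩)
        (apply_nonneg _ _) ((apply_nonneg _ _).trans h1))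
    | ha a b ha hb =>
      obtain ⟨c, hc⟩ := ha
      obtain ⟨d, hd⟩ := hb
      refine ⟨c + d, ?_⟩
      rintro _ ⟨p, hp, rfl⟩
      exact (map_add_le_add p.toSeminorm a b).trans
        (add_le_add (hc ⟨p, hp, rfl⟩) (hd ⟨p, hp, rfl⟩))

/-- The C*-algebra `A(X)` of a finite graph `X`: the universal unital C*-algebra generated by the
entries of a magic unitary matrix that commutes with the adjacency matrix of `X`. -/
def QuantumAut (X : SimpleGraph V) : Type _ := UniversalCStar (graphRelations X)

namespace QuantumAut

variable (X : SimpleGraph V)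

noncomputable instance : CStarAlgebra (QuantumAut X) :=
  inferInstanceAs (CStarAlgebra (UniversalCStar (graphRelations X)))

/-- The universal magic unitary matrix, with entries in `A(X)`. -/
noncomputable def u : Matrix V V (QuantumAut X) :=
  fun i j => UniversalCStar.of (graphRelations X) (FreeStar.gen (i, j))

open Classical in
theorem map_commutator {B : Type*} [Ring B] [StarRing B] [Algebra ℂ B]
    (f : FreeStar (V × V) →⋆ₐ[ℂ] B) (i j : V) :
    f ((X.adjMatrix (FreeStar (V × V)) * genMatrix V
      - genMatrix V * X.adjMatrix (FreeStar (V × V))) i j) =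
    (X.adjMatrix B * (genMatrix V).map f - (genMatrix V).map f * X.adjMatrix B) i j := by
  simp only [Matrix.sub_apply, Matrix.mul_apply, map_sub, map_sum, map_mul, Matrix.map_apply,
    SimpleGraph.adjMatrix_apply, apply_ite f, map_one, map_zero]

theorem u_isMagicUnitary : IsMagicUnitary (u X) where
  isStarProjection i j := by
    refine ⟨?_, ?_⟩
    · have h := UniversalCStar.of_eq_zero (graphRelations X)
        (r := genMatrix V i j * genMatrix V i j - genMatrix V i j) (Or.inl ⟨i, j, rfl⟩)
      rw [map_sub, map_mul, sub_eq_zero] at h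
      exact h
    · exact (map_star (UniversalCStar.of (graphRelations X)) _).symm.trans
        (congrArg _ (FreeStar.star_gen (i, j)))
  row_orthogonal i j k hjk := by
    have h := UniversalCStar.of_eq_zero (graphRelations X)
      (r := genMatrix V i j * genMatrix V i k) (Or.inr (Or.inl ⟨i, j, k, hjk, rfl⟩))
    rw [map_mul] at h
    exact h
  col_orthogonal i j k hij := by
    have h := UniversalCStar.of_eq_zero (graphRelations X)
      (r := genMatrix V i k * genMatrix V j k) (Or.inr (Or.inr (Or.inl ⟨i, j, k, hij, rfl⟩)))
    rw [map_mul] at h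
    exact h
  row_sum i := by
    have h := UniversalCStar.of_eq_zero (graphRelations X)
      (r := ∑ j, genMatrix V i j - 1) (Or.inr (Or.inr (Or.inr (Or.inl ⟨i, rfl⟩))))
    rw [map_sub, map_sum, map_one, sub_eq_zero] at h
    exact h
  col_sum j := by
    have h := UniversalCStar.of_eq_zero (graphRelations X)
      (r := ∑ i, genMatrix V i j - 1) (Or.inr (Or.inr (Or.inr (Or.inr (Or.inl ⟨j, rfl⟩)))))
    rw [map_sub, map_sum, map_one, sub_eq_zero] at h
    exact h

open Classical in
theorem adjMatrix_mul_u :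
    X.adjMatrix (QuantumAut X) * u X = u X * X.adjMatrix (QuantumAut X) := by
  ext i j
  have h := UniversalCStar.of_eq_zero (graphRelations X)
    (r := (X.adjMatrix (FreeStar (V × V)) * genMatrix V
      - genMatrix V * X.adjMatrix (FreeStar (V × V))) i j)
    (Or.inr (Or.inr (Or.inr (Or.inr (Or.inr ⟨i, j, rfl⟩)))))
  rw [map_commutator, Matrix.sub_apply, sub_eq_zero] at h
  exact h

variable {X} {B : Type*} [CStarAlgebra B]

open Classical in
/-- The universal property of `A(X)`. -/
noncomputable def lift (w : Matrix V V B) (hw : IsMagicUnitary w)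
    (hd : X.adjMatrix B * w = w * X.adjMatrix B) : QuantumAut X →⋆ₐ[ℂ] B :=
  UniversalCStar.lift
    (FreeStar.lift (fun s : V × V => w s.1 s.2) fun s => (hw.isStarProjection s.1 s.2).2) (by
      have e : ∀ i j, FreeStar.lift (fun s : V × V => w s.1 s.2)
          (fun s => (hw.isStarProjection s.1 s.2).2) (genMatrix V i j) = w i j :=
        fun i j => FreeStar.lift_gen _ _ (i, j)
      rintro r (⟨i, j, rfl⟩ | ⟨i, j, k, h, rfl⟩ | ⟨i, j, k, h, rfl⟩ | ⟨i, rfl⟩ | ⟨j, rfl⟩ |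
        ⟨i, j, rfl⟩)
      · rw [map_sub, map_mul, e, sub_eq_zero]
        exact (hw.isStarProjection i j).1
      · rw [map_mul, e, e, hw.row_orthogonal i j k h]
      · rw [map_mul, e, e, hw.col_orthogonal i j k h]
      · rw [map_sub, map_sum, map_one, sub_eq_zero, ← hw.row_sum i]
        exact Finset.sum_congr rfl fun j _ => e i j
      · rw [map_sub, map_sum, map_one, sub_eq_zero, ← hw.col_sum j]
        exact Finset.sum_congr rfl fun i _ => e i j
      · rw [map_commutator]
        have e' : (genMatrix V).map (FreeStar.lift (fun s : V × V => w s.1 s.2)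
          (fun s => (hw.isStarProjection s.1 s.2).2)) = w := Matrix.ext e
        rw [e', hd, sub_self, Matrix.zero_apply])

open Classical in
@[simp]
theorem lift_u (w : Matrix V V B) (hw : IsMagicUnitary w)
    (hd : X.adjMatrix B * w = w * X.adjMatrix B) (i j : V) : lift w hw hd (u X i j) = w i j :=
  (UniversalCStar.lift_of _ _ _).trans (FreeStar.lift_gen _ _ (i, j))

theorem hom_ext {f g : QuantumAut X →⋆ₐ[ℂ] B} (h : ∀ i j, f (u X i j) = g (u X i j)) : f = g := by
  refine UniversalCStar.hom_ext fun a => ?_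
  induction a using FreeStar.induction with
  | hz z =>
    rw [AlgHomClass.commutes]
    exact (AlgHomClass.commutes f z).trans (AlgHomClass.commutes g z).symm
  | hg s => exact h s.1 s.2
  | hm a b h1 h2 =>
    rw [map_mul]
    exact (map_mul f _ _).trans ((congrArg₂ _ h1 h2).trans (map_mul g _ _).symm)
  | ha a b h1 h2 =>
    rw [map_add]
    exact (map_add f _ _).trans ((congrArg₂ _ h1 h2).trans (map_add g _ _).symm)

end QuantumAut

theorem IsMagicUnitary.map {A B : Type*} [Ring A] [StarRing A] [Ring B] [StarRing B] [Algebra ℂ A]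
    [Algebra ℂ B] {u : Matrix V V A} (hu : IsMagicUnitary u) (f : A →⋆ₐ[ℂ] B) :
    IsMagicUnitary (u.map f) where
  isStarProjection i j := by
    refine ⟨?_, ?_⟩
    · change f (u i j) * f (u i j) = f (u i j)
      rw [← map_mul, (hu.isStarProjection i j).1]
    · change star (f (u i j)) = f (u i j)
      rw [← map_star, (hu.isStarProjection i j).2]
  row_orthogonal i j k h := by
    change f (u i j) * f (u i k) = 0
    rw [← map_mul, hu.row_orthogonal i j k h, map_zero]
  col_orthogonal i j k h := by
    change f (u i k) * f (u j k) = 0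
    rw [← map_mul, hu.col_orthogonal i j k h, map_zero]
  row_sum i := by
    change ∑ j, f (u i j) = 1
    rw [← map_sum, hu.row_sum, map_one]
  col_sum j := by
    change ∑ i, f (u i j) = 1
    rw [← map_sum, hu.col_sum, map_one]

theorem IsMagicUnitary.mul {A : Type*} [Ring A] [StarRing A] {u v : Matrix V V A}
    (hu : IsMagicUnitary u) (hv : IsMagicUnitary v)
    (h : ∀ i j k l, Commute (u i j) (v k l)) : IsMagicUnitary (u * v) where
  isStarProjection i j := by
    classical
    refine ⟨?_, ?_⟩
    · change (u * v) i j * (u * v) i j = (u * v) i j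
      rw [Matrix.mul_apply, Finset.sum_mul_sum]
      refine Finset.sum_congr rfl fun k _ => ?_
      rw [Finset.sum_eq_single k]
      · rw [mul_assoc, ← mul_assoc (v k j), ← (h i k k j).eq, mul_assoc (u i k) (v k j),
          (hv.isStarProjection k j).1, ← mul_assoc, (hu.isStarProjection i k).1]
      · intro l _ hl
        rw [mul_assoc, ← mul_assoc (v k j), ← (h i l k j).eq, mul_assoc (u i l) (v k j),
          ← mul_assoc, hu.row_orthogonal i k l hl.symm, zero_mul]
      · simp
    · change star ((u * v) i j) = (u * v) i j
      rw [Matrix.mul_apply, star_sum]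
      refine Finset.sum_congr rfl fun k _ => ?_
      rw [star_mul, (hv.isStarProjection k j).2, (hu.isStarProjection i k).2, (h i k k j).eq]
  row_orthogonal i j m hjm := by
    rw [Matrix.mul_apply, Matrix.mul_apply, Finset.sum_mul_sum]
    refine Finset.sum_eq_zero fun k _ => Finset.sum_eq_zero fun l _ => ?_
    rw [mul_assoc, ← mul_assoc (v k j), ← (h i l k j).eq, mul_assoc (u i l) (v k j), ← mul_assoc]
    by_cases hkl : k = l
    · rw [← hkl, hv.row_orthogonal k j m hjm, mul_zero]
    · rw [hu.row_orthogonal i k l hkl, zero_mul]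
  col_orthogonal i j m hij := by
    rw [Matrix.mul_apply, Matrix.mul_apply, Finset.sum_mul_sum]
    refine Finset.sum_eq_zero fun k _ => Finset.sum_eq_zero fun l _ => ?_
    rw [mul_assoc, ← mul_assoc (v k m), ← (h j l k m).eq, mul_assoc (u j l) (v k m), ← mul_assoc]
    by_cases hkl : k = l
    · rw [← hkl, hu.col_orthogonal i j k hij, zero_mul]
    · rw [hv.col_orthogonal k l m hkl, mul_zero]
  row_sum i := by
    simp only [Matrix.mul_apply]
    rw [Finset.sum_comm]
    simp only [← Finset.mul_sum, hv.row_sum, mul_one, hu.row_sum]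
  col_sum j := by
    simp only [Matrix.mul_apply]
    rw [Finset.sum_comm]
    simp only [← Finset.sum_mul, hu.col_sum, one_mul, hv.col_sum]

open Classical in
theorem adjMatrix_mul_map (X : SimpleGraph V) {A B : Type*} [Ring A] [StarRing A] [Ring B]
    [StarRing B] [Algebra ℂ A] [Algebra ℂ B] {u : Matrix V V A}
    (hu : X.adjMatrix A * u = u * X.adjMatrix A) (f : A →⋆ₐ[ℂ] B) :
    X.adjMatrix B * u.map f = u.map f * X.adjMatrix B := by
  ext i j
  have h := congrArg f (congrFun (congrFun hu i) j)
  simpa only [Matrix.mul_apply, map_sum, map_mul, Matrix.map_apply, SimpleGraph.adjMatrix_apply,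
    apply_ite f, map_one, map_zero] using h

namespace QuantumAut

variable (X : SimpleGraph V)

open Classical in
theorem counit_aux : IsMagicUnitary (1 : Matrix V V ℂ) where
  isStarProjection i j := by
    rw [Matrix.one_apply]
    split_ifs
    · exact .one ℂ
    · exact .zero ℂ
  row_orthogonal i j k h := by
    rw [Matrix.one_apply, Matrix.one_apply]
    split_ifs with h1 h2
    · exact absurd (h1.symm.trans h2) h
    all_goals simp
  col_orthogonal i j k h := by
    rw [Matrix.one_apply, Matrix.one_apply]
    split_ifs with h1 h2
    · exact absurd (h1.trans h2.symm) h
    all_goals simp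
  row_sum i := by simp [Matrix.one_apply]
  col_sum j := by simp [Matrix.one_apply]

open Classical in
/-- The counit `ε (u i j) = δ i j` of `A(X)`. -/
noncomputable def counit : QuantumAut X →⋆ₐ[ℂ] ℂ :=
  lift (1 : Matrix V V ℂ) counit_aux (by rw [mul_one, one_mul])

theorem comul_aux : (fun i j => ∑ k, MaxTensor.tmul (u X i k) (u X k j) :
      Matrix V V (MaxTensor (QuantumAut X) (QuantumAut X))) =
    (u X).map (MaxTensor.inl _ (QuantumAut X)) * (u X).map (MaxTensor.inr (QuantumAut X) _) := by
  ext i j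
  exact Finset.sum_congr rfl fun k _ => MaxTensor.tmul_eq _ _

/-- The comultiplication `Δ (u i j) = ∑ k, u i k ⊗ u k j` of `A(X)`. -/
noncomputable def comul : QuantumAut X →⋆ₐ[ℂ] MaxTensor (QuantumAut X) (QuantumAut X) :=
  lift (fun i j => ∑ k, MaxTensor.tmul (u X i k) (u X k j))
    (by
      rw [comul_aux]
      exact ((u_isMagicUnitary X).map (MaxTensor.inl _ (QuantumAut X))).mul
        ((u_isMagicUnitary X).map (MaxTensor.inr (QuantumAut X) _))
        (fun i j k l => MaxTensor.inl_commute_inr _ _))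
    (by
      classical
      rw [comul_aux, ← mul_assoc, adjMatrix_mul_map X (adjMatrix_mul_u X), mul_assoc,
        adjMatrix_mul_map X (adjMatrix_mul_u X), mul_assoc])

/-- The antipode `S (u i j) = u j i` of `A(X)`. -/
noncomputable def antipode : QuantumAut X →⋆ₐ[ℂ] (QuantumAut X)ᵐᵒᵖ :=
  lift (fun i j => op (u X j i))
    { isStarProjection := fun i j => by
        have h := (u_isMagicUnitary X).isStarProjection j i
        refine ⟨?_, ?_⟩
        · change op (u X j i) * op (u X j i) = op (u X j i)
          rw [← op_mul, h.1]
        · change star (op (u X j i)) = op (u X j i)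
          rw [← op_star, h.2]
      row_orthogonal := fun i j k h => by
        rw [← op_mul, (u_isMagicUnitary X).col_orthogonal k j i h.symm, op_zero]
      col_orthogonal := fun i j k h => by
        rw [← op_mul, (u_isMagicUnitary X).row_orthogonal k j i h.symm, op_zero]
      row_sum := fun i => by
        rw [← Finset.op_sum, (u_isMagicUnitary X).col_sum, op_one]
      col_sum := fun j => by
        rw [← Finset.op_sum, (u_isMagicUnitary X).row_sum, op_one] }
    (by
      classical
      ext i j
      apply unop_injective
      have h := congrFun (congrFun (adjMatrix_mul_u X) j) i
      change unop ((X.adjMatrix (QuantumAut X)ᵐᵒᵖ *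
          (Matrix.of fun i j => op (u X j i) : Matrix V V (QuantumAut X)ᵐᵒᵖ)) i j)
        = unop (((Matrix.of fun i j => op (u X j i) : Matrix V V (QuantumAut X)ᵐᵒᵖ) *
          X.adjMatrix (QuantumAut X)ᵐᵒᵖ) i j)
      change (X.adjMatrix (QuantumAut X) * u X) j i = (u X * X.adjMatrix (QuantumAut X)) j i at h
      simp only [Matrix.mul_apply, Matrix.of_apply, SimpleGraph.adjMatrix_apply, ite_mul, mul_ite,
        one_mul, mul_one,
        zero_mul, mul_zero, Finset.unop_sum, apply_ite unop, unop_op, unop_zero] at h ⊢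
      simp only [X.adj_comm i, X.adj_comm _ j]
      exact h.symm)

@[simp]
theorem comul_u (i j : V) : comul X (u X i j) = ∑ k, MaxTensor.tmul (u X i k) (u X k j) :=
  lift_u _ _ _ i j

open Classical in
theorem counit_u (i j : V) : counit X (u X i j) = if i = j then 1 else 0 :=
  (lift_u _ _ _ i j).trans (Matrix.one_apply)

@[simp]
theorem antipode_u (i j : V) : antipode X (u X i j) = op (u X j i) :=
  lift_u _ _ _ i j

theorem dense_adjoin :
    Dense (StarAlgebra.adjoin ℂ {a | ∃ i j, a = u X i j} : Set (QuantumAut X)) := by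
  set T := StarAlgebra.adjoin ℂ {a | ∃ i j, a = u X i j} with hT
  have hTmem : ∀ a, UniversalCStar.of (graphRelations X) a ∈ T := by
    intro a
    induction a using FreeStar.induction with
    | hz z =>
      rw [AlgHomClass.commutes]
      exact algebraMap_mem T z
    | hg s => exact StarAlgebra.subset_adjoin ℂ _ ⟨s.1, s.2, rfl⟩
    | hm a b h1 h2 => rw [map_mul]; exact mul_mem h1 h2
    | ha a b h1 h2 => rw [map_add]; exact add_mem h1 h2
  refine (UniversalCStar.denseRange_of (graphRelations X)).mono ?_
  rintro _ ⟨a, rfl⟩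
  exact hTmem a

/-- The Hopf C*-algebra structure of `A(X)`. -/
noncomputable instance : HopfCStarAlgebra (QuantumAut X) where
  comul := comul X
  counit := counit X
  antipode := antipode X
  coassoc := by
    refine hom_ext fun i j => ?_
    simp only [StarAlgHom.comp_apply, comul_u, map_sum, MaxTensor.tmul_eq, map_mul,
      MaxTensor.map_inl, MaxTensor.map_inr, MaxTensor.assoc_inl, MaxTensor.assoc_inr,
      StarAlgHom.coe_id, id_eq, Finset.sum_mul, Finset.mul_sum]
    rw [Finset.sum_comm]
    simp only [mul_assoc]
  counit_left := by
    classical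
    refine hom_ext fun i j => ?_
    simp only [StarAlgHom.comp_apply, comul_u, map_sum, MaxTensor.tmul_eq, map_mul,
      MaxTensor.map_inl, MaxTensor.map_inr, MaxTensor.lid_inl, MaxTensor.lid_inr,
      StarAlgHom.coe_id, id_eq, counit_u]
    simp [apply_ite (algebraMap ℂ (QuantumAut X))]
  counit_right := by
    classical
    refine hom_ext fun i j => ?_
    simp only [StarAlgHom.comp_apply, comul_u, map_sum, MaxTensor.tmul_eq, map_mul,
      MaxTensor.map_inl, MaxTensor.map_inr, MaxTensor.rid_inl, MaxTensor.rid_inr,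
      StarAlgHom.coe_id, id_eq, counit_u]
    simp [apply_ite (algebraMap ℂ (QuantumAut X))]
  antipode_antipode := DFunLike.congr_fun (f := antipodeSq (antipode X))
    (g := .id ℂ (QuantumAut X)) (hom_ext fun i j => by
      change unop (antipode X (unop (antipode X (u X i j)))) = u X i j
      rw [antipode_u, unop_op, antipode_u, unop_op])
  exists_dense := by
    have hmem : ∀ i j, u X i j ∈ StarAlgebra.adjoin ℂ {a | ∃ i j, a = u X i j} :=
      fun i j => StarAlgebra.subset_adjoin ℂ _ ⟨i, j, rfl⟩
    have hu := u_isMagicUnitary X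
    refine exists_dense_of_generators {a | ∃ i j, a = u X i j} ?_ (dense_adjoin X) ?_ ?_
    · ext a
      constructor
      · rintro ⟨i, j, h⟩
        exact ⟨i, j, by rw [← star_star a, h, (hu.isStarProjection i j).2]⟩
      · rintro ⟨i, j, rfl⟩
        exact ⟨i, j, (hu.isStarProjection i j).2⟩
    · rintro _ ⟨i, j, rfl⟩
      rw [antipode_u]
      exact hmem j i
    · classical
      rintro _ ⟨i, j, rfl⟩
      refine ⟨∑ k, (⟨u X i k, hmem i k⟩ ⊗ₜ[ℂ] ⟨u X k j, hmem k j⟩), ?_, ?_, ?_⟩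
      · rw [comul_u, map_sum, map_sum]
        rfl
      · rw [map_sum, map_sum, counit_u]
        change ∑ k, unop (antipode X (u X i k)) * u X k j = _
        simp only [antipode_u, unop_op]
        split_ifs with h
        · subst h
          rw [map_one, ← hu.col_sum i]
          exact Finset.sum_congr rfl fun k _ => (hu.isStarProjection k i).1
        · rw [map_zero]
          exact Finset.sum_eq_zero fun k _ => hu.row_orthogonal k i j h
      · rw [map_sum, map_sum, counit_u]
        change ∑ k, u X i k * unop (antipode X (u X k j)) = _
        simp only [antipode_u, unop_op]
        split_ifs with h
        · subst h
          rw [map_one, ← hu.row_sum i]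
          exact Finset.sum_congr rfl fun k _ => (hu.isStarProjection i k).1
        · rw [map_zero]
          exact Finset.sum_eq_zero fun k _ => hu.col_orthogonal i j k h

end QuantumAut

end Graph

/-! In the tensor product the elements `u i j ⊗ 1` commute with the elements `1 ⊗ v α β`, and the
matrix with entries `u i j ⊗ v α β` is the Kronecker product of these two magic unitaries. Over
commuting entries such a product is again a magic unitary (`IsMagicUnitary.kronecker`). By the
universal property of the source, a *-homomorphism with the prescribed values exists as soon as this
matrix commutes with the adjacency matrix of the product graph.

With d and e the adjacency matrices of X and Y, that of the direct product is d ⊗ e and that of the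
Cartesian product is d ⊗ 1 + 1 ⊗ e. All entries of these factors are 0 or 1, hence central, so the
mixed product rule (M ⊗ P)(N ⊗ Q) = MN ⊗ PQ (`Matrix.kronecker_mul_kronecker_of_commute`) applies
although the coefficient algebra is noncommutative. It reduces the claim to du = ud and ev = ve.

Compatibility with Δ, ε and S is an equality of *-homomorphisms on the source, so it is checked on
generators, where it uses only the formula for the values and not the graph.

For surjectivity, summing `u i j ⊗ v α β` over β gives `u i j ⊗ 1`, and summing over j gives `1 ⊗ v
α β`; hence the range contains a dense *-subalgebra. Since the target is a completion, this is
enough only because the range of a *-homomorphism of C*-algebras is closed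
(`StarAlgHom.isClosed_range_cstar`). That fact comes from functional calculus: self-adjoint elements
of the range lift without increase of norm, arbitrary ones with a factor of at most 2, and such
bounded lifting passes to the closure by completeness. -/

/-! ### The range of a *-homomorphism of C*-algebras -/

section Range

variable {A B : Type*} [CStarAlgebra A] [CStarAlgebra B]

/-- A self-adjoint element in the range of a *-homomorphism of C*-algebras has a
preimage whose norm is not larger. -/
theorem StarAlgHom.exists_norm_le_of_isSelfAdjoint (f : A →⋆ₐ[ℂ] B) {b : B}
    (hb : IsSelfAdjoint b) (h : b ∈ Set.range f) : ∃ a, f a = b ∧ ‖a‖ ≤ ‖b‖ := by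
  -- The bound of the spectrum by the norm, used below, relies on ‖1‖ = 1, which fails in the zero
  -- algebra.
  rcases subsingleton_or_nontrivial B with hB | hB
  · exact ⟨0, Subsingleton.elim _ _, by rw [norm_zero]; exact norm_nonneg b⟩
  obtain ⟨a, rfl⟩ := h
  set r := ‖f a‖ with hr
  have hr0 : 0 ≤ r := norm_nonneg _
  -- Since `f a` is self-adjoint, the real part of any preimage is again a preimage, and it admits a
  -- real functional calculus.
  have hre : f (realPart a : A) = f a := by
    rw [realPart_apply_coe]
    refine (map_smul ((f : A →ₗ[ℂ] B).restrictScalars ℝ) _ _).trans ?_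
    change (2⁻¹ : ℝ) • f (a + star a) = f a
    rw [map_add, map_star, hb.star_eq, ← two_smul ℝ (f a), smul_smul]
    norm_num
  have hsa : IsSelfAdjoint (realPart a : A) := (realPart a).2
  -- `g` truncates to the interval [-r, r]. This interval contains the spectrum of `f a`, so `g`
  -- fixes `f a`; and |g| ≤ r everywhere, so applying `g` upstairs brings the norm down to at most
  -- r. Both facts meet because `f` commutes with the functional calculus.
  let g : ℝ → ℝ := fun t => max (-r) (min t r)
  have hg : Continuous g := by fun_prop
  have hcont := f.continuous_cstar
  refine ⟨cfc g (realPart a : A), ?_, ?_⟩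
  · rw [StarAlgHom.map_cfc (R := ℝ) (S := ℂ) (p := IsSelfAdjoint)
      (q := IsSelfAdjoint) f g (realPart a : A) hg.continuousOn hcont hsa
      (by rw [hre]; exact hb), hre]
    have : cfc g (f a) = cfc (id : ℝ → ℝ) (f a) := by
      refine cfc_congr fun t ht => ?_
      have h1 : |t| ≤ r := spectrum.norm_le_norm_of_mem ht
      rw [abs_le] at h1
      change max (-r) (min t r) = t
      rw [min_eq_left h1.2, max_eq_right h1.1]
    rw [this, cfc_id ℝ (f a) hb]
  · refine norm_cfc_le hr0 fun t _ => ?_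
    rw [Real.norm_eq_abs, abs_le]
    exact ⟨le_max_left _ _, max_le (by linarith) (min_le_right _ _)⟩

/-- An element in the range of a *-homomorphism of C*-algebras has a preimage of at most twice its
norm. -/
theorem StarAlgHom.exists_norm_le_two_mul (f : A →⋆ₐ[ℂ] B) (a : A) :
    ∃ a', f a' = f a ∧ ‖a'‖ ≤ 2 * ‖f a‖ := by
  have hre : f (realPart a : A) = (realPart (f a) : B) := by
    rw [realPart_apply_coe, realPart_apply_coe, ← map_star, ← map_add]
    exact map_smul ((f : A →ₗ[ℂ] B).restrictScalars ℝ) _ _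
  have him : f (imaginaryPart a : A) = (imaginaryPart (f a) : B) := by
    rw [imaginaryPart_apply_coe, imaginaryPart_apply_coe, ← map_star, ← map_sub, map_smul]
    congr 1
    exact map_smul ((f : A →ₗ[ℂ] B).restrictScalars ℝ) _ _
  -- The real and imaginary parts are lifted separately, each with norm at most that of `f a`; the
  -- triangle inequality then gives the factor 2.
  obtain ⟨x, hx, hxn⟩ := f.exists_norm_le_of_isSelfAdjoint (realPart (f a)).2 ⟨_, hre⟩
  obtain ⟨y, hy, hyn⟩ := f.exists_norm_le_of_isSelfAdjoint (imaginaryPart (f a)).2 ⟨_, him⟩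
  refine ⟨x + Complex.I • y, ?_, ?_⟩
  · rw [map_add, map_smul, hx, hy, realPart_add_I_smul_imaginaryPart]
  · have h1 : ‖(realPart (f a) : B)‖ ≤ ‖f a‖ := realPart.norm_le (f a)
    have h2 : ‖(imaginaryPart (f a) : B)‖ ≤ ‖f a‖ := imaginaryPart.norm_le (f a)
    calc ‖x + Complex.I • y‖ ≤ ‖x‖ + ‖Complex.I • y‖ := norm_add_le _ _
      _ = ‖x‖ + ‖y‖ := by rw [norm_smul, Complex.norm_I, one_mul]
      _ ≤ 2 * ‖f a‖ := by linarith

/-- The range of a *-homomorphism of C*-algebras is closed. -/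
theorem StarAlgHom.isClosed_range_cstar (f : A →⋆ₐ[ℂ] B) : IsClosed (Set.range f) := by
  let φ : NormedAddGroupHom A B := AddMonoidHom.mkNormedAddGroupHom (f : A →+ B) 1 fun a => by
    rw [one_mul]; exact NonUnitalStarAlgHom.norm_apply_le f a
  have h : φ.SurjectiveOnWith φ.range 2 := by
    rintro _ ⟨a, rfl⟩
    exact f.exists_norm_le_two_mul a
  -- An element of the closure is a convergent series of elements of the range with norms under
  -- control; the lifts of the terms with bound 2 then sum in the complete space `A`. The 1 is an
  -- arbitrary slack in the constant, which plays no role afterwards.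
  have h' := controlled_closure_of_complete two_pos one_pos h
  refine isClosed_of_closure_subset fun b hb => ?_
  obtain ⟨a, ha, -⟩ := h' b hb
  exact ⟨a, ha⟩

/-- The range is a *-subalgebra, so it contains everything generated by `s`, and it is closed, so it
contains the closure as well. -/
theorem StarAlgHom.surjective_of_dense_adjoin (f : A →⋆ₐ[ℂ] B) {s : Set B}
    (hs : Dense (StarAlgebra.adjoin ℂ s : Set B)) (h : s ⊆ Set.range f) :
    Function.Surjective f := by
  have hle : StarAlgebra.adjoin ℂ s ≤ f.range := StarAlgebra.adjoin_le h
  intro b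
  exact closure_minimal (fun x hx => hle hx) f.isClosed_range_cstar (hs b)

end Range

/-! ### Kronecker products of magic unitaries -/

section Kronecker

open scoped Kronecker

variable {V W A : Type*}

/-- Entrywise the two sides differ only in the order of the middle factors `P α γ` and `N k j`. No
other pair of factors has to be exchanged, so the rule holds over a noncommutative `A`. -/
theorem Matrix.kronecker_mul_kronecker_of_commute [Fintype V] [Fintype W] [Semiring A]
    (M N : Matrix V V A) (P Q : Matrix W W A) (h : ∀ i j α β, Commute (N i j) (P α β)) :
    (M ⊗ₖ P) * (N ⊗ₖ Q) = (M * N) ⊗ₖ (P * Q) := by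
  ext ⟨i, α⟩ ⟨j, β⟩
  simp only [Matrix.mul_apply, Matrix.kroneckerMap_apply, Fintype.sum_prod_type,
    Finset.sum_mul_sum]
  refine Finset.sum_congr rfl fun k _ => Finset.sum_congr rfl fun γ _ => ?_
  rw [mul_assoc, mul_assoc, ← mul_assoc (P α γ), ← (h k j α γ).eq, mul_assoc (N k j)]

/-- A product of commuting projections is a projection. Two distinct index pairs differ in at least
one coordinate, and the orthogonality of the corresponding factor kills the product. Row and column
sums factor into those of `u` and `v`. -/
theorem IsMagicUnitary.kronecker [Fintype V] [Fintype W] [Ring A] [StarRing A]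
    {u : Matrix V V A} {v : Matrix W W A} (hu : IsMagicUnitary u) (hv : IsMagicUnitary v)
    (h : ∀ i j α β, Commute (u i j) (v α β)) : IsMagicUnitary (u ⊗ₖ v) := by
  -- Collecting the entries of `u` on the left and those of `v` on the right lets each orthogonality
  -- relation act on adjacent factors.
  have swap : ∀ i j k l α β γ δ, u i j * v α β * (u k l * v γ δ)
      = u i j * u k l * (v α β * v γ δ) := fun i j k l α β γ δ => by
    rw [mul_assoc, mul_assoc, ← mul_assoc (v α β), ← (h k l α β).eq, mul_assoc (u k l)]
  refine ⟨?_, ?_, ?_, ?_, ?_⟩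
  · rintro ⟨i, α⟩ ⟨j, β⟩
    exact (hu.isStarProjection i j).mul (hv.isStarProjection α β) (h i j α β)
  · rintro ⟨i, α⟩ ⟨j, β⟩ ⟨k, γ⟩ hne
    rw [Matrix.kroneckerMap_apply, Matrix.kroneckerMap_apply, swap]
    by_cases hjk : j = k
    · rw [hv.row_orthogonal α β γ fun h => hne (Prod.ext hjk h), mul_zero]
    · rw [hu.row_orthogonal i j k hjk, zero_mul]
  · rintro ⟨i, α⟩ ⟨j, β⟩ ⟨k, γ⟩ hne
    rw [Matrix.kroneckerMap_apply, Matrix.kroneckerMap_apply, swap]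
    by_cases hij : i = j
    · rw [hv.col_orthogonal α β γ fun h => hne (Prod.ext hij h), mul_zero]
    · rw [hu.col_orthogonal i j k hij, zero_mul]
  · rintro ⟨i, α⟩
    simp only [Matrix.kroneckerMap_apply, Fintype.sum_prod_type, ← Finset.mul_sum, hv.row_sum,
      mul_one, hu.row_sum]
  · rintro ⟨j, β⟩
    simp only [Matrix.kroneckerMap_apply, Fintype.sum_prod_type, ← Finset.mul_sum, hv.col_sum,
      mul_one, hu.col_sum]

open Classical in
-- The indicator of a conjunction is the product of the indicators.
theorem adjMatrix_directProduct [Semiring A] (X : SimpleGraph V) (Y : SimpleGraph W) :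
    (directProduct X Y).adjMatrix A = X.adjMatrix A ⊗ₖ Y.adjMatrix A := by
  ext ⟨i, α⟩ ⟨j, β⟩
  have h : (directProduct X Y).Adj (i, α) (j, β) ↔ X.Adj i j ∧ Y.Adj α β := Iff.rfl
  rw [Matrix.kroneckerMap_apply]
  simp only [SimpleGraph.adjMatrix_apply, h]
  by_cases hX : X.Adj i j <;> by_cases hY : Y.Adj α β <;> simp [hX, hY]

open Classical in
-- The two kinds of edges exclude each other because `X` and `Y` have no loops, so the indicator of
-- the disjunction is the plain sum of the indicators, with no term to subtract.
theorem adjMatrix_boxProd [Semiring A] (X : SimpleGraph V) (Y : SimpleGraph W) :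
    (X.boxProd Y).adjMatrix A
      = X.adjMatrix A ⊗ₖ (1 : Matrix W W A) + (1 : Matrix V V A) ⊗ₖ Y.adjMatrix A := by
  ext ⟨i, α⟩ ⟨j, β⟩
  simp only [SimpleGraph.adjMatrix_apply, Matrix.add_apply, Matrix.kroneckerMap_apply,
    SimpleGraph.boxProd_adj, Matrix.one_apply]
  by_cases hij : i = j <;> by_cases hαβ : α = β <;> simp [hij, hαβ]

open Classical in
-- Entries equal to 0 or 1 are central. Together with the same remark for the identity matrix, this
-- supplies the hypothesis of the mixed product rule whenever one of the two Kronecker products is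
-- built from adjacency and identity matrices.
theorem adjMatrix_commute [Semiring A] (X : SimpleGraph V) (i j : V) (a : A) :
    Commute (X.adjMatrix A i j) a := by
  rw [SimpleGraph.adjMatrix_apply]
  split_ifs
  · exact Commute.one_left a
  · exact Commute.zero_left a

open Classical in
theorem Matrix.one_apply_commute [Semiring A] (i j : V) (a : A) :
    Commute ((1 : Matrix V V A) i j) a := by
  rw [Matrix.one_apply]
  split_ifs
  · exact Commute.one_left a
  · exact Commute.zero_left a

open Classical in
-- With d and e the two adjacency matrices, (d ⊗ e)(u ⊗ v) = du ⊗ ev = ud ⊗ ve = (u ⊗ v)(d ⊗ e).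
-- Only entries of d and e move past other factors, so `u` and `v` need not commute with each other
-- here.
theorem adjMatrix_directProduct_mul_kronecker [Fintype V] [Fintype W] [Semiring A]
    {X : SimpleGraph V} {Y : SimpleGraph W} {u : Matrix V V A} {v : Matrix W W A}
    (hu : X.adjMatrix A * u = u * X.adjMatrix A) (hv : Y.adjMatrix A * v = v * Y.adjMatrix A) :
    (directProduct X Y).adjMatrix A * (u ⊗ₖ v) = (u ⊗ₖ v) * (directProduct X Y).adjMatrix A := by
  rw [adjMatrix_directProduct, Matrix.kronecker_mul_kronecker_of_commute,
    Matrix.kronecker_mul_kronecker_of_commute, hu, hv]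
  · exact fun _ _ _ _ => adjMatrix_commute _ _ _ _
  · exact fun _ _ _ _ => (adjMatrix_commute _ _ _ _).symm

open Classical in
-- Each of the summands d ⊗ 1 and 1 ⊗ e commutes with u ⊗ v, by the mixed product rule; it is
-- applied four times, twice on each side.
theorem adjMatrix_boxProd_mul_kronecker [Fintype V] [Fintype W] [Semiring A]
    {X : SimpleGraph V} {Y : SimpleGraph W} {u : Matrix V V A} {v : Matrix W W A}
    (hu : X.adjMatrix A * u = u * X.adjMatrix A) (hv : Y.adjMatrix A * v = v * Y.adjMatrix A) :
    (X.boxProd Y).adjMatrix A * (u ⊗ₖ v) = (u ⊗ₖ v) * (X.boxProd Y).adjMatrix A := by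
  rw [adjMatrix_boxProd, add_mul, mul_add, Matrix.kronecker_mul_kronecker_of_commute,
    Matrix.kronecker_mul_kronecker_of_commute, Matrix.kronecker_mul_kronecker_of_commute,
    Matrix.kronecker_mul_kronecker_of_commute, hu, hv, one_mul, one_mul, mul_one, mul_one]
  · exact fun _ _ _ _ => Matrix.one_apply_commute _ _ _
  · exact fun _ _ _ _ => adjMatrix_commute _ _ _ _
  · exact fun _ _ _ _ => (adjMatrix_commute _ _ _ _).symm
  · exact fun _ _ _ _ => (Matrix.one_apply_commute _ _ _).symm

end Kronecker

/-! ### The morphisms to the tensor product -/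

namespace QuantumAut

open scoped Kronecker
open MulOpposite

variable {V W : Type*} [Fintype V] [Fintype W] (X : SimpleGraph V) (Y : SimpleGraph W)

/-- The matrix with entries `u i j ⊗ v α β`. -/
noncomputable def tensorMatrix :
    Matrix (V × W) (V × W) (MaxTensor (QuantumAut X) (QuantumAut Y)) :=
  (u X).map (MaxTensor.inl _ (QuantumAut Y)) ⊗ₖ (u Y).map (MaxTensor.inr (QuantumAut X) _)

theorem tensorMatrix_apply (i j : V) (α β : W) :
    tensorMatrix X Y (i, α) (j, β) = MaxTensor.tmul (u X i j) (u Y α β) :=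
  (MaxTensor.tmul_eq _ _).symm

theorem tensorMatrix_isMagicUnitary : IsMagicUnitary (tensorMatrix X Y) :=
  ((u_isMagicUnitary X).map _).kronecker ((u_isMagicUnitary Y).map _)
    fun _ _ _ _ => MaxTensor.inl_commute_inr _ _

variable {X Y} {Z : SimpleGraph (V × W)}
  {φ : QuantumAut Z →⋆ₐ[ℂ] MaxTensor (QuantumAut X) (QuantumAut Y)}

/-- Each compatibility equates two *-homomorphisms on `QuantumAut Z`, so generators suffice. `Z` is
an arbitrary graph on the pairs: only the values of `φ` matter, and one argument serves both
products. -/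
theorem isHopfCStarHom_of_apply_u (hφ : ∀ (i j : V) (α β : W),
    φ (u Z (i, α) (j, β)) = MaxTensor.tmul (u X i j) (u Y α β)) : IsHopfCStarHom φ where
  comul_apply := by
    refine DFunLike.congr_fun (f := (MaxTensor.tensorComul _ _).comp φ)
      (g := (MaxTensor.map φ φ).comp (comul Z)) (hom_ext ?_)
    rintro ⟨i, α⟩ ⟨j, β⟩
    have hX : HopfCStarAlgebra.comul (u X i j) = ∑ k, MaxTensor.tmul (u X i k) (u X k j) :=
      comul_u X i j
    have hY : HopfCStarAlgebra.comul (u Y α β) = ∑ k, MaxTensor.tmul (u Y α k) (u Y k β) :=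
      comul_u Y α β
    rw [StarAlgHom.comp_apply, StarAlgHom.comp_apply, hφ, comul_u, MaxTensor.tmul_eq, map_mul,
      MaxTensor.tensorComul_inl, MaxTensor.tensorComul_inr, hX, hY]
    simp only [map_sum, MaxTensor.tmul_eq, map_mul, MaxTensor.map_inl, MaxTensor.map_inr,
      Fintype.sum_prod_type, Finset.sum_mul_sum, hφ]
    refine Finset.sum_congr rfl fun k _ => Finset.sum_congr rfl fun γ _ => ?_
    -- The second leg of Δ(u) and the first leg of Δ(v) change places: this is the flip in the
    -- comultiplication of the tensor product.
    exact ((MaxTensor.inl_commute_inr _ _).symm.mul_mul_mul_comm _ _)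
  counit_apply := by
    refine DFunLike.congr_fun (f := (MaxTensor.tensorCounit _ _).comp φ)
      (g := counit Z) (hom_ext ?_)
    rintro ⟨i, α⟩ ⟨j, β⟩
    classical
    rw [StarAlgHom.comp_apply, hφ, counit_u, MaxTensor.tmul_eq, map_mul,
      MaxTensor.tensorCounit_inl, MaxTensor.tensorCounit_inr]
    refine (congrArg₂ (· * ·) (counit_u X i j) (counit_u Y α β)).trans ?_
    -- A Kronecker delta of pairs is the product of the deltas of the coordinates.
    by_cases hij : i = j <;> by_cases hαβ : α = β <;> simp [hij, hαβ]
  antipode_apply a := by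
    -- With values in the opposite algebra both composites are *-homomorphisms, so agreement on
    -- generators can be used.
    refine congrArg unop (DFunLike.congr_fun (f := (MaxTensor.tensorAntipode _ _).comp φ)
      (g := (opHom φ).comp (antipode Z)) (hom_ext ?_) a)
    rintro ⟨i, α⟩ ⟨j, β⟩
    have hX : HopfCStarAlgebra.antipode (u X i j) = op (u X j i) := antipode_u X i j
    have hY : HopfCStarAlgebra.antipode (u Y α β) = op (u Y β α) := antipode_u Y α β
    apply unop_injective
    rw [StarAlgHom.comp_apply, StarAlgHom.comp_apply, unop_opHom, antipode_u, unop_op, hφ, hφ,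
      MaxTensor.tmul_eq, MaxTensor.tmul_eq, map_mul, MaxTensor.tensorAntipode_inl,
      MaxTensor.tensorAntipode_inr, hX, hY]
    -- The opposite multiplication reverses the product and leaves `(1 ⊗ v β α) * (u j i ⊗ 1)`; the
    -- legs commute, so this is `u j i ⊗ v β α`.
    exact (MaxTensor.inl_commute_inr _ _).symm.eq

/-- The row sums of one magic unitary being 1, partial sums of generators are mapped to `u i j ⊗ 1`
and to `1 ⊗ v α β`, which generate a dense *-subalgebra. -/
theorem surjective_of_apply_u [Nonempty V] [Nonempty W] (hφ : ∀ (i j : V) (α β : W),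
    φ (u Z (i, α) (j, β)) = MaxTensor.tmul (u X i j) (u Y α β)) : Function.Surjective φ := by
  -- Any row of `v` sums to 1, so its index is arbitrary; a row exists because `W` is nonempty.
  -- Below, `V` plays the same role.
  have hl : ∀ i j, φ (∑ β, u Z (i, Classical.arbitrary W) (j, β))
      = MaxTensor.inl _ (QuantumAut Y) (u X i j) := fun i j => by
    simp only [map_sum, hφ, MaxTensor.tmul_eq]
    rw [← Finset.mul_sum, ← map_sum, (u_isMagicUnitary Y).row_sum, map_one, mul_one]
  have hr : ∀ α β, φ (∑ j, u Z (Classical.arbitrary V, α) (j, β))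
      = MaxTensor.inr (QuantumAut X) _ (u Y α β) := fun α β => by
    simp only [map_sum, hφ, MaxTensor.tmul_eq]
    rw [← Finset.sum_mul, ← map_sum, (u_isMagicUnitary X).row_sum, map_one, one_mul]
  refine φ.surjective_of_dense_adjoin (MaxTensor.dense_adjoin (dense_adjoin X) (dense_adjoin Y)) ?_
  rintro _ (⟨a, ha, rfl⟩ | ⟨b, hb, rfl⟩)
  -- Here `a` is any element of the *-subalgebra generated by the entries of `u`. The elements whose
  -- image under `inl` lies in the range of `φ` form a *-subalgebra, so it suffices to treat the
  -- entries.
  · have hle : StarAlgebra.adjoin ℂ {a | ∃ i j, a = u X i j}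
        ≤ φ.range.comap (MaxTensor.inl _ (QuantumAut Y)) := by
      refine StarAlgebra.adjoin_le ?_
      rintro _ ⟨i, j, rfl⟩
      exact ⟨_, hl i j⟩
    exact hle ha
  · have hle : StarAlgebra.adjoin ℂ {a | ∃ i j, a = u Y i j}
        ≤ φ.range.comap (MaxTensor.inr (QuantumAut X) _) := by
      refine StarAlgebra.adjoin_le ?_
      rintro _ ⟨α, β, rfl⟩
      exact ⟨_, hr α β⟩
    exact hle hb

/-- This isolates what the two product graphs share: all that remains for each is a *-homomorphism
with the prescribed values, that is, the commutation with its adjacency matrix. -/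
theorem exists_hom_tensor [Nonempty V] [Nonempty W] (φ : QuantumAut Z →⋆ₐ[ℂ] _)
    (hφ : ∀ x y, φ (u Z x y) = tensorMatrix X Y x y) :
    ∃ φ : QuantumAut Z →⋆ₐ[ℂ] MaxTensor (QuantumAut X) (QuantumAut Y),
      IsHopfCStarHom φ ∧ Function.Surjective φ ∧ ∀ (i j : V) (α β : W),
        φ (u Z (i, α) (j, β)) = MaxTensor.tmul (u X i j) (u Y α β) := by
  have h : ∀ (i j : V) (α β : W),
      φ (u Z (i, α) (j, β)) = MaxTensor.tmul (u X i j) (u Y α β) :=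
    fun i j α β => (hφ _ _).trans (tensorMatrix_apply X Y i j α β)
  exact ⟨φ, isHopfCStarHom_of_apply_u h, surjective_of_apply_u h, h⟩

end QuantumAut

theorem proposition4p1 {V W : Type*} [Fintype V] [Fintype W] [Nonempty V] [Nonempty W]
    (X : SimpleGraph V) (Y : SimpleGraph W) :
    (∃ φ : QuantumAut (directProduct X Y) →⋆ₐ[ℂ] MaxTensor (QuantumAut X) (QuantumAut Y),
      IsHopfCStarHom φ ∧ Function.Surjective φ ∧
      ∀ (i j : V) (α β : W), φ (QuantumAut.u (directProduct X Y) (i, α) (j, β))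
        = MaxTensor.tmul (QuantumAut.u X i j) (QuantumAut.u Y α β)) ∧
    (∃ φ : QuantumAut (X.boxProd Y) →⋆ₐ[ℂ] MaxTensor (QuantumAut X) (QuantumAut Y),
      IsHopfCStarHom φ ∧ Function.Surjective φ ∧
      ∀ (i j : V) (α β : W), φ (QuantumAut.u (X.boxProd Y) (i, α) (j, β))
        = MaxTensor.tmul (QuantumAut.u X i j) (QuantumAut.u Y α β)) := by
  classical
  -- The relations du = ud and ev = ve are carried into the tensor product, one along each leg, so
  -- that the Kronecker computations take place over a single algebra.
  have hX := adjMatrix_mul_map X (QuantumAut.adjMatrix_mul_u X)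
    (MaxTensor.inl _ (QuantumAut Y))
  have hY := adjMatrix_mul_map Y (QuantumAut.adjMatrix_mul_u Y)
    (MaxTensor.inr (QuantumAut X) _)
  exact ⟨QuantumAut.exists_hom_tensor _
      (QuantumAut.lift_u _ (QuantumAut.tensorMatrix_isMagicUnitary X Y)
        (adjMatrix_directProduct_mul_kronecker hX hY)),
    QuantumAut.exists_hom_tensor _
      (QuantumAut.lift_u _ (QuantumAut.tensorMatrix_isMagicUnitary X Y)
        (adjMatrix_boxProd_mul_kronecker hX hY))⟩
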